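/- Let $k\ge 1$ and $A=\mathbb C[t_2^{\pm1},\dots,t_k^{\pm1}]$. Let $\mathfrak g$ be a finite-dimensional simple Lie algebra over $\mathbb C$ with Cartan subalgebra $\mathfrak h$, a base $\alpha_1,\dots,\alpha_n$ of its root system, highest root $\theta$, and invariant form $(\cdot|\cdot)$ normalized by $(\theta|\theta)=2$. Let $\mathcal T(\mathfrak g)=\mathfrak g\otimes\mathbb C[t_1^{\pm1},\dots,t_k^{\pm1}]\oplus\mathcal Z\oplus\bigoplus_{i=1}^k\mathbb C d_i$ be the toroidal Lie algebra, where $\mathcal Z$ is spanned by the central elements $t^{\mathbf m}K_i$ ($\mathbf m\in\mathbb Z^k$, $1\le i\le k$) with relations $\sum_i m_i\,t^{\mathbf m}K_i=0$, where $$[x\otimes t^{\mathbf m},y\otimes t^{\mathbf n}]=[x,y]\otimes t^{\mathbf m+\mathbf n}+(x|y)\sum_i m_i\,t^{\mathbf m+\mathbf n}K_i ,$$ and where $d_i$ acts on elements of degree $\mathbf m$ as multiplication by $m_i$ ("central" means commuting with $\mathfrak g\otimes\mathbb C[t_1^{\pm1},\dots,t_k^{\pm1}]$ and $\mathcal Z$).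 For $k=1$ this is the affine algebra $\mathfrak g_{aff}=\mathfrak g\otimes\mathbb C[t_1^{\pm1}]\oplus\mathbb CK_1\oplus\mathbb Cd_1$; put $\mathfrak h_{aff}=\mathfrak h\oplus\mathbb CK_1\oplus\mathbb Cd_1$, $\alpha_{n+1}^\vee=K_1-\theta^\vee$, and $P^+_{aff}=\{\lambda\in\mathfrak h_{aff}^*:\lambda(\alpha_i^\vee)\in\mathbb Z_{\ge0},\ 1\le i\le n+1\}$. For $\lambda\in P_{aff}^+$ let $X(\lambda)$ be the irreducible $\mathfrak g_{aff}$-module of highest weight $\lambda$. Let $\pi:\max A\to P^+_{aff}$ be finitely supported, $\Lambda=\sum_M\pi(M)$, $X_\pi=\bigotimes_{M\in\operatorname{supp}\pi}X(\pi(M))$, and let $v_\pi$ be the tensor product of highest weight vectors. On $X_\pi$ let $Y\otimes f$ ($Y\in\mathfrak g\otimes\mathbb C[t_1^{\pm1}]\oplus\mathbb CK_1\oplus\mathbb Cd_1$, $f\in A$) act as $\sum_M\mathrm{ev}_M(f)\,Y^{(M)}$, where $Y^{(M)}$ is $Y$ acting on the factor indexed by $M$. On $L(X_\pi)=X_\pi\otimes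 A$ let $Y\otimes t^{\mathbf m}$ act by $w\otimes f\mapsto(Y\otimes t^{\mathbf m})w\otimes t^{\mathbf m}f$ for $\mathbf m\in\mathbb Z^{k-1}$, extended linearly; let $t^{\mathbf m}K_j$ ($j\ge2$) act by $0$, $d_1$ by $w\otimes f\mapsto d_1w\otimes f$, and $d_i$ ($i\ge2$) by $w\otimes f\mapsto w\otimes d_if$. This makes $L(X_\pi)$ a $\mathcal T(\mathfrak g)$-module. Identify $v_\pi$ with $v_\pi\otimes1$. Let $\mathfrak b\subset\mathcal T(\mathfrak g)$ be the Lie subalgebra spanned by all $h\otimes t^{\mathbf m}$ and $t^{\mathbf m}K_i$ ($h\in\mathfrak h$, $\mathbf m\in\mathbb Z^{k-1}$, $1\le i\le k$) and by $d_1$. For a monomial $a\in A$ and $1\le i\le n+1$ let $p^s_{\alpha_i,a}$ be the coefficient of $u^s$ in $\exp\bigl(-\sum_{q\ge1}(\alpha_i^\vee\otimes a^q)u^q/q\bigr)$. Let $\mathbf A_\Lambda=U(\mathfrak b)/I_\Lambda$, where $I_\Lambda$ is the two-sided ideal generated by $h-\Lambda(h)$ ($h\in\mathfrak h_{aff}$),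 $t^{\mathbf m}K_j$ ($j\ge2$, $\mathbf m\in\mathbb Z^{k-1}$), and, for all $1\le i\le n+1$, monomials $a\in A$ and $s>\Lambda(\alpha_i^\vee)$, the elements $p^s_{\alpha_i,a}$ and $\sum_{l=0}^s(\alpha_i^\vee\otimes a^{s-l})p^l_{\alpha_i,a}$. Then: 1. The action of $U(\mathfrak b)$ on $U(\mathfrak b)v_\pi\subseteq L(X_\pi)$ factors through $\mathbf A_\Lambda$, so that $\mathbf A_\Lambda v_\pi:=U(\mathfrak b)v_\pi$ is an $\mathbf A_\Lambda$-module. 2. The set $G_\pi=\{\mathbf m\in\mathbb Z^{k-1}:\ \mathbf A_\Lambda v_\pi\cap(X_\pi\otimes t^{\mathbf m})\neq0\}$ is a subgroup of $\mathbb Z^{k-1}$. If $\Lambda(K_1)\neq0$, then $G_\pi$ has rank $k-1$, and hence finite index in $\mathbb Z^{k-1}$. 3. If $\mathbf A_\Lambda v_\pi$ is replaced by the subspace generated from $v_\pi$ by all operators $Y\otimes t^{\mathbf m}$ with $Y\in\mathfrak h_{aff}$ (thus including $d_1\otimes t^{\mathbf m}$) and $\mathbf m\in\mathbb Z^{k-1}$,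 then the set of degrees is again a subgroup of $\mathbb Z^{k-1}$, and it has rank $k-1$ and finite index whenever $\pi\neq0$. -/

import Mathlib

open scoped TensorProduct

noncomputable section

namespace Toroidal

/-- Laurent polynomials `ℂ[t₁^{±1},…,t_k^{±1}]`; the monomial `t^m` is `single m 1`. -/
abbrev Laurent (k : ℕ) : Type := AddMonoidAlgebra ℂ (Fin k → ℤ)

/-- The monomial `t^m`. -/
abbrev mono {k : ℕ} (m : Fin k → ℤ) : Laurent k := AddMonoidAlgebra.single m 1

/-- Linear maps out of `ℂ[t₁^{±1},…,t_k^{±1}]` are given by the images of the monomials. -/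
def extend {k : ℕ} {V : Type*} [AddCommGroup V] [Module ℂ V] (f : (Fin k → ℤ) → V) :
    Laurent k →ₗ[ℂ] V :=
  (AddMonoidAlgebra.basis (Fin k → ℤ) ℂ).constr ℂ f

@[simp] theorem extend_mono {k : ℕ} {V : Type*} [AddCommGroup V] [Module ℂ V]
    (f : (Fin k → ℤ) → V) (m : Fin k → ℤ) : extend f (mono m) = f m := by
  have := (AddMonoidAlgebra.basis (Fin k → ℤ) ℂ).constr_basis ℂ f m
  simpa [extend] using this

theorem laurent_hom_ext {k : ℕ} {V : Type*} [AddCommGroup V] [Module ℂ V]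
    {f g : Laurent k →ₗ[ℂ] V} (h : ∀ m, f (mono m) = g (mono m)) : f = g :=
  (AddMonoidAlgebra.basis (Fin k → ℤ) ℂ).ext (fun m => by simpa using h m)

/-- The exact differentials `∑ i, m i • t^m K_i = d(t^m)`. -/
def exactForms (k : ℕ) : Submodule ℂ ((Fin k → ℤ) →₀ (Fin k → ℂ)) :=
  Submodule.span ℂ (Set.range fun m : Fin k → ℤ => Finsupp.single m fun i => (m i : ℂ))

/-- `𝒵 = Ω_k / dL_k`: spanned by the `t^m K_i`, with relations `∑ i, m i • t^m K_i = 0`. -/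
abbrev Cen (k : ℕ) : Type := ((Fin k → ℤ) →₀ (Fin k → ℂ)) ⧸ exactForms k

/-- The class of `∑ i, w i • t^m K_i`. -/
def cenMk {k : ℕ} (m : Fin k → ℤ) : (Fin k → ℂ) →ₗ[ℂ] Cen k :=
  (exactForms k).mkQ ∘ₗ Finsupp.lsingle m

theorem cenMk_self {k : ℕ} (m : Fin k → ℤ) : cenMk m (fun i => (m i : ℂ)) = 0 := by
  simp only [cenMk, LinearMap.comp_apply, Finsupp.lsingle_apply, Submodule.mkQ_apply,
    Submodule.Quotient.mk_eq_zero]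
  exact Submodule.subset_span ⟨m, rfl⟩

/-- Linear maps out of `𝒵`. -/
def cenLift {k : ℕ} {V : Type*} [AddCommGroup V] [Module ℂ V]
    (f : (Fin k → ℤ) → (Fin k → ℂ) →ₗ[ℂ] V) (hf : ∀ m, f m (fun i => (m i : ℂ)) = 0) :
    Cen k →ₗ[ℂ] V :=
  (exactForms k).liftQ (Finsupp.lsum ℂ f) <| by
    rw [exactForms, Submodule.span_le]
    rintro _ ⟨m, rfl⟩
    simpa using hf m

@[simp] theorem cenLift_mk {k : ℕ} {V : Type*} [AddCommGroup V] [Module ℂ V]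
    (f : (Fin k → ℤ) → (Fin k → ℂ) →ₗ[ℂ] V) (hf : ∀ m, f m (fun i => (m i : ℂ)) = 0)
    (m : Fin k → ℤ) (w : Fin k → ℂ) : cenLift f hf (cenMk m w) = f m w := by
  simp [cenLift, cenMk]

theorem cen_hom_ext {k : ℕ} {V : Type*} [AddCommGroup V] [Module ℂ V]
    {f g : Cen k →ₗ[ℂ] V} (h : ∀ m w, f (cenMk m w) = g (cenMk m w)) : f = g := by
  apply Submodule.linearMap_qext
  ext m w
  simpa [cenMk] using h m (Pi.single w 1)

/-- `∑ i, u i • m i`, the eigenvalue of `∑ i, u i • d_i` in degree `m`. -/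
def deg {k : ℕ} (u : Fin k → ℂ) (m : Fin k → ℤ) : ℂ := ∑ i, u i * (m i : ℂ)

@[simp] theorem deg_zero {k : ℕ} (m : Fin k → ℤ) : deg 0 m = 0 := by simp [deg]

theorem deg_add {k : ℕ} (u : Fin k → ℂ) (m n : Fin k → ℤ) :
    deg u (m + n) = deg u m + deg u n := by
  simp [deg, mul_add, Finset.sum_add_distrib]

/-- The derivation `∑ i, u i • d_i` on `𝒵`: `t^m K_j ↦ (∑ i, u i * m i) t^m K_j`. -/
def cenDer {k : ℕ} (u : Fin k → ℂ) : Cen k →ₗ[ℂ] Cen k :=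
  cenLift (fun m => deg u m • cenMk m) fun m => by simp [cenMk_self]

variable {g : Type*} [LieRing g] [LieAlgebra ℂ g]

/-- `g ⊗ ℂ[t₁^{±1},…,t_k^{±1}]`, where `x ⊗ t^m` is `single m x`. -/
abbrev Loop (g : Type*) [LieRing g] (k : ℕ) : Type _ := (Fin k → ℤ) →₀ g

theorem loop_hom_ext {k : ℕ} {V : Type*} [AddCommGroup V] [Module ℂ V]
    {f h : Loop g k →ₗ[ℂ] V}
    (H : ∀ m x, f (Finsupp.single m x) = h (Finsupp.single m x)) : f = h :=
  Finsupp.lhom_ext H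

/-- Bilinear maps out of `Loop g k`, given on pairs `x ⊗ t^m`, `y ⊗ t^n`. -/
def loopLift₂ {k : ℕ} {V : Type*} [AddCommGroup V] [Module ℂ V]
    (f : (Fin k → ℤ) → (Fin k → ℤ) → g →ₗ[ℂ] g →ₗ[ℂ] V) :
    Loop g k →ₗ[ℂ] Loop g k →ₗ[ℂ] V :=
  Finsupp.lsum ℂ fun m => LinearMap.flip <| Finsupp.lsum ℂ fun n => (f m n).flip

@[simp] theorem loopLift₂_single {k : ℕ} {V : Type*} [AddCommGroup V] [Module ℂ V]
    (f : (Fin k → ℤ) → (Fin k → ℤ) → g →ₗ[ℂ] g →ₗ[ℂ] V) (m n : Fin k → ℤ) (x y : g) :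
    loopLift₂ f (Finsupp.single m x) (Finsupp.single n y) = f m n x y := by
  simp [loopLift₂]

/-- `(x ⊗ t^m, y ⊗ t^n) ↦ [x, y] ⊗ t^{m+n}`. -/
def loopBracket (g : Type*) [LieRing g] [LieAlgebra ℂ g] (k : ℕ) :
    Loop g k →ₗ[ℂ] Loop g k →ₗ[ℂ] Loop g k :=
  loopLift₂ fun m n =>
    (LieModule.toEnd ℂ g g : g →ₗ[ℂ] Module.End ℂ g).compr₂ (Finsupp.lsingle (m + n))

@[simp] theorem loopBracket_single {k : ℕ} (m n : Fin k → ℤ) (x y : g) :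
    loopBracket g k (Finsupp.single m x) (Finsupp.single n y) =
      Finsupp.single (m + n) ⁅x, y⁆ := by
  simp [loopBracket]

/-- `(x ⊗ P, y ⊗ Q) ↦ (x|y) • class of Q dP`, where `(x|y) = c * κ(x, y)`; on monomials
`(x ⊗ t^m, y ⊗ t^n) ↦ (x|y) • ∑ i, m i • t^{m+n} K_i`. -/
def cocycle (g : Type*) [LieRing g] [LieAlgebra ℂ g] (c : ℂ) (k : ℕ) :
    Loop g k →ₗ[ℂ] Loop g k →ₗ[ℂ] Cen k :=
  loopLift₂ fun m n =>
    (c • killingForm ℂ g).compr₂ (LinearMap.toSpanSingleton ℂ _ (cenMk (m + n) fun i => (m i : ℂ)))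

@[simp] theorem cocycle_single (c : ℂ) {k : ℕ} (m n : Fin k → ℤ) (x y : g) :
    cocycle g c k (Finsupp.single m x) (Finsupp.single n y) =
      (c * killingForm ℂ g x y) • cenMk (m + n) fun i => (m i : ℂ) := by
  simp [cocycle]

/-- The derivation `∑ i, u i • d_i` on `g ⊗ ℂ[t₁^{±1},…,t_k^{±1}]`:
`x ⊗ t^m ↦ (∑ i, u i * m i) x ⊗ t^m`. -/
def loopDer {k : ℕ} (u : Fin k → ℂ) : Loop g k →ₗ[ℂ] Loop g k :=
  Finsupp.lsum ℂ fun m => deg u m • Finsupp.lsingle m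

@[simp] theorem loopDer_single {k : ℕ} (u : Fin k → ℂ) (m : Fin k → ℤ) (x : g) :
    loopDer u (Finsupp.single m x) = deg u m • Finsupp.single m x := by
  simp [loopDer]

@[simp] theorem cenDer_mk {k : ℕ} (u : Fin k → ℂ) (m : Fin k → ℤ) (w : Fin k → ℂ) :
    cenDer u (cenMk m w) = deg u m • cenMk m w := by
  simp [cenDer]

/-- Induction on elements of `g ⊗ ℂ[t₁^{±1},…,t_k^{±1}]`. -/
theorem loop_ind {g : Type*} [LieRing g] {k : ℕ} {p : Loop g k → Prop} (h0 : p 0)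
    (h1 : ∀ m x, p (Finsupp.single m x)) (h2 : ∀ a b, p a → p b → p (a + b)) (a) : p a := by
  induction a using Finsupp.induction_linear with
  | zero => exact h0
  | add a b ha hb => exact h2 a b ha hb
  | single m s => exact h1 m s

theorem cen_ind {k : ℕ} {p : Cen k → Prop} (h0 : p 0)
    (h1 : ∀ m w, p (cenMk m w)) (h2 : ∀ a b, p a → p b → p (a + b)) (a) : p a := by
  induction a using Submodule.Quotient.induction_on with
  | H a =>
    induction a using Finsupp.induction_linear with
    | zero => simpa using h0
    | add a b ha hb => exact h2 _ _ ha hb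
    | single m w => exact h1 m w

theorem loopDer_bracket {k : ℕ} (u : Fin k → ℂ) (a b : Loop g k) :
    loopDer u (loopBracket g k a b) =
      loopBracket g k (loopDer u a) b + loopBracket g k a (loopDer u b) := by
  induction a using loop_ind with
  | h0 => simp
  | h2 a a' h h' => simp only [LinearMap.add_apply, map_add, h, h']; abel
  | h1 m x =>
    induction b using loop_ind with
    | h0 => simp
    | h2 a a' h h' => simp only [map_add, h, h']; abel
    | h1 n y =>
      simp only [loopBracket_single, loopDer_single, deg_add, add_smul, map_smul,
        LinearMap.smul_apply]

theorem loopBracket_skew {k : ℕ} (a b : Loop g k) :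
    loopBracket g k a b = - loopBracket g k b a := by
  induction a using loop_ind with
  | h0 => simp
  | h2 a a' h h' => simp only [LinearMap.add_apply, map_add, h, h']; abel
  | h1 m x =>
    induction b using loop_ind with
    | h0 => simp
    | h2 a a' h h' => simp only [LinearMap.add_apply, map_add, h, h']; abel
    | h1 n y =>
      rw [loopBracket_single, loopBracket_single, ← Finsupp.single_neg, lie_skew, add_comm]

theorem loopBracket_self {k : ℕ} (a : Loop g k) : loopBracket g k a a = 0 := by
  have := loopBracket_skew a a
  have h2 : (2 : ℂ) • loopBracket g k a a = 0 := by
    rw [two_smul]; nth_rewrite 1 [this]; simp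
  exact (smul_eq_zero.mp h2).resolve_left two_ne_zero

theorem loopBracket_jacobi {k : ℕ} (a b d : Loop g k) :
    loopBracket g k a (loopBracket g k b d) =
      loopBracket g k (loopBracket g k a b) d + loopBracket g k b (loopBracket g k a d) := by
  induction a using loop_ind with
  | h0 => simp
  | h2 a a' h h' => simp only [map_add, LinearMap.add_apply, h, h']; abel
  | h1 m x =>
    induction b using loop_ind with
    | h0 => simp
    | h2 a a' h h' => simp only [map_add, LinearMap.add_apply, h, h']; abel
    | h1 n y =>
      induction d using loop_ind with
      | h0 => simp
      | h2 a a' h h' => simp only [map_add, h, h']; abel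
      | h1 p z =>
        simp only [loopBracket_single]
        rw [leibniz_lie, Finsupp.single_add, ← add_assoc, ← add_assoc, add_comm n m]

theorem loopDer_comm {k : ℕ} (u v : Fin k → ℂ) (a : Loop g k) :
    loopDer u (loopDer v a) = loopDer v (loopDer u a) := by
  induction a using loop_ind with
  | h0 => simp
  | h2 a a' h h' => simp only [map_add, h, h']
  | h1 m x => simp only [loopDer_single, map_smul, smul_smul, mul_comm]

theorem cenDer_comm {k : ℕ} (u v : Fin k → ℂ) (a : Cen k) :
    cenDer u (cenDer v a) = cenDer v (cenDer u a) := by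
  induction a using cen_ind with
  | h0 => simp
  | h2 a a' h h' => simp only [map_add, h, h']
  | h1 m x => simp only [cenDer_mk, map_smul, smul_smul, mul_comm]

theorem loopDer_add {k : ℕ} (u v : Fin k → ℂ) (a : Loop g k) :
    loopDer (u + v) a = loopDer u a + loopDer v a := by
  induction a using loop_ind with
  | h0 => simp
  | h2 a a' h h' => simp only [map_add, h, h']; abel
  | h1 m x => simp [deg, add_mul, Finset.sum_add_distrib, add_smul]

theorem cenDer_add {k : ℕ} (u v : Fin k → ℂ) (a : Cen k) :
    cenDer (u + v) a = cenDer u a + cenDer v a := by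
  induction a using cen_ind with
  | h0 => simp
  | h2 a a' h h' => simp only [map_add, h, h']; abel
  | h1 m x => simp [deg, add_mul, Finset.sum_add_distrib, add_smul]

theorem loopDer_smul {k : ℕ} (s : ℂ) (u : Fin k → ℂ) (a : Loop g k) :
    loopDer (s • u) a = s • loopDer u a := by
  induction a using loop_ind with
  | h0 => simp
  | h2 a a' h h' => simp only [map_add, h, h', smul_add]
  | h1 m x => simp [deg, mul_assoc, ← Finset.mul_sum, smul_smul]

theorem cenDer_smul {k : ℕ} (s : ℂ) (u : Fin k → ℂ) (a : Cen k) :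
    cenDer (s • u) a = s • cenDer u a := by
  induction a using cen_ind with
  | h0 => simp
  | h2 a a' h h' => simp only [map_add, h, h', smul_add]
  | h1 m x => simp [deg, mul_assoc, ← Finset.mul_sum, smul_smul]

theorem cenMk_add_eq_zero {k : ℕ} (p : Fin k → ℤ) (a b : Fin k → ℂ)
    (h : ∀ i, a i + b i = p i) : cenMk p a + cenMk p b = 0 := by
  rw [← map_add, ← cenMk_self p]; congr 1; ext i; exact h i

theorem cocycle_skew (c : ℂ) {k : ℕ} (a b : Loop g k) :
    cocycle g c k a b = - cocycle g c k b a := by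
  induction a using loop_ind with
  | h0 => simp
  | h2 a a' h h' => simp only [map_add, LinearMap.add_apply, h, h']; abel
  | h1 m x =>
    induction b using loop_ind with
    | h0 => simp
    | h2 a a' h h' => simp only [map_add, LinearMap.add_apply, h, h']; abel
    | h1 n y =>
      rw [cocycle_single, cocycle_single, LieModule.traceForm_comm ℂ g g y x, ← smul_neg]
      congr 1
      rw [add_comm n m, eq_neg_iff_add_eq_zero]
      exact cenMk_add_eq_zero _ _ _ fun i => by simp

theorem cocycle_self (c : ℂ) {k : ℕ} (a : Loop g k) : cocycle g c k a a = 0 := by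
  have := cocycle_skew c a a
  have h2 : (2 : ℂ) • cocycle g c k a a = 0 := by
    rw [two_smul]; nth_rewrite 1 [this]; simp
  exact (smul_eq_zero.mp h2).resolve_left two_ne_zero

theorem cenDer_cocycle (c : ℂ) {k : ℕ} (u : Fin k → ℂ) (a b : Loop g k) :
    cenDer u (cocycle g c k a b) =
      cocycle g c k (loopDer u a) b + cocycle g c k a (loopDer u b) := by
  induction a using loop_ind with
  | h0 => simp
  | h2 a a' h h' => simp only [map_add, LinearMap.add_apply, h, h']; abel
  | h1 m x =>
    induction b using loop_ind with
    | h0 => simp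
    | h2 a a' h h' => simp only [map_add, h, h']; abel
    | h1 n y =>
      simp only [cocycle_single, loopDer_single, map_smul, LinearMap.smul_apply, cenDer_mk, deg_add]
      rw [← add_smul, smul_smul, smul_smul, mul_comm]

theorem cocycle_jacobi (c : ℂ) {k : ℕ} (a b d : Loop g k) :
    cocycle g c k a (loopBracket g k b d) =
      cocycle g c k (loopBracket g k a b) d + cocycle g c k b (loopBracket g k a d) := by
  induction a using loop_ind with
  | h0 => simp
  | h2 a a' h h' => simp only [map_add, LinearMap.add_apply, h, h']; abel
  | h1 m x =>
    induction b using loop_ind with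
    | h0 => simp
    | h2 a a' h h' => simp only [map_add, LinearMap.add_apply, h, h']; abel
    | h1 n y =>
      induction d using loop_ind with
      | h0 => simp
      | h2 a a' h h' => simp only [map_add, h, h']; abel
      | h1 p z =>
        simp only [loopBracket_single, cocycle_single]
        have e1 : killingForm ℂ g x ⁅y, z⁆ = killingForm ℂ g ⁅x, y⁆ z :=
          (LieModule.traceForm_apply_lie_apply ℂ g g x y z).symm
        have e2 : killingForm ℂ g y ⁅x, z⁆ = - killingForm ℂ g ⁅x, y⁆ z := by
          have := LieModule.traceForm_apply_lie_apply ℂ g g y x z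
          rw [← this, ← lie_skew, map_neg, LinearMap.neg_apply]
        rw [e1, e2, show n + (m + p) = m + n + p by abel, show m + (n + p) = m + n + p by abel,
          mul_neg, neg_smul, ← sub_eq_add_neg, ← smul_sub, ← map_sub]
        congr 2
        ext i; simp

end Toroidal

open Toroidal

/-- The `k`-toroidal Lie algebra `𝒯(g) = g ⊗ ℂ[t₁^{±1},…,t_k^{±1}] ⊕ 𝒵 ⊕ D_k`, formed with the
invariant form `(x|y) = c * κ(x, y)`, where `κ` is the Killing form. -/
@[ext] structure ToroidalAlgebra (g : Type*) [LieRing g] [LieAlgebra ℂ g] (c : ℂ) (k : ℕ) where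
  loop : Loop g k
  cen : Cen k
  der : Fin k → ℂ

namespace ToroidalAlgebra

variable {g : Type*} [LieRing g] [LieAlgebra ℂ g] {c : ℂ} {k : ℕ}

/-- The underlying triple. -/
def toProd : ToroidalAlgebra g c k ≃ (Loop g k) × Cen k × (Fin k → ℂ) where
  toFun X := (X.loop, X.cen, X.der)
  invFun p := ⟨p.1, p.2.1, p.2.2⟩
  left_inv _ := rfl
  right_inv _ := rfl

instance : AddCommGroup (ToroidalAlgebra g c k) := toProd.addCommGroup

instance : Module ℂ (ToroidalAlgebra g c k) := toProd.module ℂ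

@[simp] theorem add_loop (X Y : ToroidalAlgebra g c k) : (X + Y).loop = X.loop + Y.loop := rfl
@[simp] theorem add_cen (X Y : ToroidalAlgebra g c k) : (X + Y).cen = X.cen + Y.cen := rfl
@[simp] theorem add_der (X Y : ToroidalAlgebra g c k) : (X + Y).der = X.der + Y.der := rfl
@[simp] theorem smul_loop (s : ℂ) (X : ToroidalAlgebra g c k) : (s • X).loop = s • X.loop := rfl
@[simp] theorem smul_cen (s : ℂ) (X : ToroidalAlgebra g c k) : (s • X).cen = s • X.cen := rfl
@[simp] theorem smul_der (s : ℂ) (X : ToroidalAlgebra g c k) : (s • X).der = s • X.der := rfl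
@[simp] theorem zero_loop : (0 : ToroidalAlgebra g c k).loop = 0 := rfl
@[simp] theorem zero_cen : (0 : ToroidalAlgebra g c k).cen = 0 := rfl
@[simp] theorem zero_der : (0 : ToroidalAlgebra g c k).der = 0 := rfl

instance : Bracket (ToroidalAlgebra g c k) (ToroidalAlgebra g c k) where
  bracket X Y :=
    { loop := loopBracket g k X.loop Y.loop + loopDer X.der Y.loop - loopDer Y.der X.loop
      cen := cocycle g c k X.loop Y.loop + cenDer X.der Y.cen - cenDer Y.der X.cen
      der := 0 }

@[simp] theorem lie_loop (X Y : ToroidalAlgebra g c k) :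
    ⁅X, Y⁆.loop = loopBracket g k X.loop Y.loop + loopDer X.der Y.loop - loopDer Y.der X.loop := rfl
@[simp] theorem lie_cen (X Y : ToroidalAlgebra g c k) :
    ⁅X, Y⁆.cen = cocycle g c k X.loop Y.loop + cenDer X.der Y.cen - cenDer Y.der X.cen := rfl
@[simp] theorem lie_der (X Y : ToroidalAlgebra g c k) : ⁅X, Y⁆.der = 0 := rfl

theorem loopDer_zero (a : Loop g k) : loopDer 0 a = 0 := by
  simpa using loopDer_smul (0 : ℂ) 0 a

theorem cenDer_zero (a : Cen k) : cenDer 0 a = 0 := by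
  simpa using cenDer_smul (0 : ℂ) 0 a

instance : LieRing (ToroidalAlgebra g c k) where
  add_lie X Y Z := by
    ext1
    · simp only [lie_loop, add_loop, add_der, LinearMap.add_apply, map_add, loopDer_add]; abel
    · simp only [lie_cen, add_loop, add_der, add_cen, map_add, cenDer_add,
        LinearMap.add_apply]; abel
    · simp
  lie_add X Y Z := by
    ext1
    · simp only [lie_loop, add_loop, add_der, map_add, loopDer_add]; abel
    · simp only [lie_cen, add_loop, add_der, add_cen, map_add, cenDer_add]; abel
    · simp
  lie_self X := by
    ext1
    · simp [loopBracket_self]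
    · simp [cocycle_self]
    · simp
  leibniz_lie X Y Z := by
    ext1
    · simp only [lie_loop, lie_der, add_loop, loopDer_zero, map_add, map_sub,
        LinearMap.add_apply, LinearMap.sub_apply, loopDer_bracket]
      rw [loopBracket_jacobi X.loop Y.loop Z.loop, loopDer_comm X.der Y.der, loopDer_comm X.der Z.der,
        loopDer_comm Y.der Z.der, loopBracket_skew Y.loop (loopDer Z.der X.loop)]
      abel
    · simp only [lie_cen, lie_loop, lie_der, add_cen, cenDer_zero, map_add, map_sub,
        LinearMap.add_apply, LinearMap.sub_apply, cenDer_cocycle]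
      rw [cocycle_jacobi, cenDer_comm X.der Y.der, cenDer_comm X.der Z.der,
        cenDer_comm Y.der Z.der, cocycle_skew c Y.loop (loopDer Z.der X.loop)]
      abel
    · simp

instance : LieAlgebra ℂ (ToroidalAlgebra g c k) where
  lie_smul s X Y := by
    ext1
    · simp only [lie_loop, smul_loop, smul_der, map_smul, loopDer_smul, smul_add,
        smul_sub]
    · simp only [lie_cen, smul_loop, smul_der, smul_cen, map_smul, cenDer_smul, smul_add,
        smul_sub]
    · simp

end ToroidalAlgebra
attribute [local instance 100] LieRing.ofAssociativeRing

namespace ToroidalAlgebra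

variable {g : Type*} [LieRing g] [LieAlgebra ℂ g] {c : ℂ} {k : ℕ}

/-- `x ⊗ t^m`. -/
def loopEl (m : Fin k → ℤ) : g →ₗ[ℂ] ToroidalAlgebra g c k where
  toFun x := ⟨Finsupp.single m x, 0, 0⟩
  map_add' x y := by ext1 <;> simp
  map_smul' s x := by ext1 <;> simp

/-- `∑ i, w i • t^m K_i`. -/
def cenEl (m : Fin k → ℤ) : (Fin k → ℂ) →ₗ[ℂ] ToroidalAlgebra g c k where
  toFun w := ⟨0, cenMk m w, 0⟩
  map_add' x y := by ext1 <;> simp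
  map_smul' s x := by ext1 <;> simp

/-- `∑ i, u i • d_i`. -/
def derEl : (Fin k → ℂ) →ₗ[ℂ] ToroidalAlgebra g c k where
  toFun u := ⟨0, 0, u⟩
  map_add' x y := by ext1 <;> simp
  map_smul' s x := by ext1 <;> simp

theorem lie_loopEl_loopEl (m n : Fin k → ℤ) (x y : g) :
    ⁅(loopEl m x : ToroidalAlgebra g c k), (loopEl n y : ToroidalAlgebra g c k)⁆ =
      loopEl (m + n) ⁅x, y⁆ + (c * killingForm ℂ g x y) • cenEl (m + n) fun i => (m i : ℂ) := by
  ext1 <;> simp [loopEl, cenEl]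

theorem lie_cenEl_loopEl (m n : Fin k → ℤ) (w : Fin k → ℂ) (y : g) :
    ⁅(cenEl m w : ToroidalAlgebra g c k), (loopEl n y : ToroidalAlgebra g c k)⁆ = 0 := by
  ext1 <;> simp [loopEl, cenEl]

theorem lie_cenEl_cenEl (m n : Fin k → ℤ) (w w' : Fin k → ℂ) :
    ⁅(cenEl m w : ToroidalAlgebra g c k), (cenEl n w' : ToroidalAlgebra g c k)⁆ = 0 := by
  ext1 <;> simp [cenEl]

theorem lie_derEl_loopEl (u : Fin k → ℂ) (n : Fin k → ℤ) (y : g) :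
    ⁅(derEl u : ToroidalAlgebra g c k), (loopEl n y : ToroidalAlgebra g c k)⁆ =
      deg u n • loopEl n y := by
  ext1 <;> simp [loopEl, derEl]

theorem lie_derEl_cenEl (u : Fin k → ℂ) (n : Fin k → ℤ) (w : Fin k → ℂ) :
    ⁅(derEl u : ToroidalAlgebra g c k), (cenEl n w : ToroidalAlgebra g c k)⁆ =
      deg u n • cenEl n w := by
  ext1 <;> simp [cenEl, derEl]

theorem lie_derEl_derEl (u v : Fin k → ℂ) :
    ⁅(derEl u : ToroidalAlgebra g c k), (derEl v : ToroidalAlgebra g c k)⁆ = 0 := by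
  ext1 <;> simp [derEl]

theorem cenEl_self (m : Fin k → ℤ) :
    (cenEl m (fun i => (m i : ℂ)) : ToroidalAlgebra g c k) = 0 := by
  ext1 <;> simp [cenEl, cenMk_self]

end ToroidalAlgebra

open ToroidalAlgebra

/-- The affine Kac-Moody algebra `g ⊗ ℂ[t₁^{±1}] ⊕ ℂK₁ ⊕ ℂd₁`, as the case `k = 1` of the
toroidal Lie algebra. -/
abbrev AffineAlgebra (g : Type*) [LieRing g] [LieAlgebra ℂ g] (c : ℂ) : Type _ :=
  ToroidalAlgebra g c 1

namespace Toroidal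

/-! ### Evaluation modules -/

section Evaluation

/-- The tensor product `X₁ ⊗ ⋯ ⊗ X_l` over `ℂ`. -/
def TensorModule {ι : Type*} (X : ι → Type*) [∀ i, AddCommGroup (X i)] [∀ i, Module ℂ (X i)] :
    Type _ :=
  ⨂[ℂ] i, X i

instance {ι : Type*} (X : ι → Type*) [∀ i, AddCommGroup (X i)] [∀ i, Module ℂ (X i)] :
    AddCommGroup (TensorModule X) :=
  inferInstanceAs (AddCommGroup (⨂[ℂ] i, X i))

instance {ι : Type*} (X : ι → Type*) [∀ i, AddCommGroup (X i)] [∀ i, Module ℂ (X i)] :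
    Module ℂ (TensorModule X) :=
  inferInstanceAs (Module ℂ (⨂[ℂ] i, X i))

/-- The space `L(X₁ ⊗ ⋯ ⊗ X_l) = (X₁ ⊗ ⋯ ⊗ X_l) ⊗ ℂ[t₂^{±1},…,t_k^{±1}]`, where `r = k - 1`. -/
abbrev LoopModule (r : ℕ) {ι : Type*} (X : ι → Type*) [∀ i, AddCommGroup (X i)]
    [∀ i, Module ℂ (X i)] : Type _ :=
  TensorModule X ⊗[ℂ] Laurent r

variable {r : ℕ} {ι : Type*} (X : ι → Type*) [∀ i, AddCommGroup (X i)] [∀ i, Module ℂ (X i)]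

/-- The pure tensor `v₁ ⊗ ⋯ ⊗ v_l`. -/
def pureTensor (v : ∀ i, X i) : TensorModule X := PiTensorProduct.tprod ℂ v

/-- The derivation `∑ i, u i • d_i` of the Laurent polynomials. -/
def laurentDer (u : Fin r → ℂ) : Laurent r →ₗ[ℂ] Laurent r :=
  extend fun m => deg u m • mono m

/-- `w ⊗ f ↦ ∑ i, u i • (w ⊗ d_i f)`. -/
def degreeOp : (Fin r → ℂ) →ₗ[ℂ] Module.End ℂ (LoopModule r X) where
  toFun u := LinearMap.lTensor _ (laurentDer u)
  map_add' u v := by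
    rw [← LinearMap.lTensor_add]; congr 1
    apply laurent_hom_ext; intro m
    simp [laurentDer, deg, add_mul, Finset.sum_add_distrib, add_smul]
  map_smul' s u := by
    rw [RingHom.id_apply, ← LinearMap.lTensor_smul]; congr 1
    apply laurent_hom_ext; intro m
    simp [laurentDer, deg, mul_assoc, ← Finset.mul_sum]

theorem degreeOp_tmul (u : Fin r → ℂ) (w : TensorModule X) (m : Fin r → ℤ) :
    degreeOp X u (w ⊗ₜ mono m) = deg u m • (w ⊗ₜ mono m) := by
  simp only [degreeOp, LinearMap.coe_mk, AddHom.coe_mk, LinearMap.lTensor_tmul, laurentDer,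
    extend_mono, TensorProduct.tmul_smul]

theorem loopModule_hom_ext {V : Type*} [AddCommGroup V] [Module ℂ V]
    {f h : LoopModule r X →ₗ[ℂ] V} (H : ∀ w m, f (w ⊗ₜ mono m) = h (w ⊗ₜ mono m)) : f = h :=
  TensorProduct.ext <| LinearMap.ext fun w => laurent_hom_ext fun m => H w m

open Classical in
/-- `v₁ ⊗ ⋯ ⊗ v_l ↦ v₁ ⊗ ⋯ ⊗ T v_i ⊗ ⋯ ⊗ v_l`. -/
def legMap (i : ι) : Module.End ℂ (X i) →ₗ[ℂ] Module.End ℂ (TensorModule X) where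
  toFun T := (PiTensorProduct.map (Function.update (fun j => (1 : Module.End ℂ (X j))) i T) :
    (⨂[ℂ] i, X i) →ₗ[ℂ] ⨂[ℂ] i, X i)
  map_add' S T := PiTensorProduct.map_update_add _ i S T
  map_smul' s T := PiTensorProduct.map_update_smul _ i s T

theorem legMap_mul (i : ι) (S T : Module.End ℂ (X i)) :
    legMap X i (S * T) = legMap X i S * legMap X i T := by
  classical
  have key : Function.update (fun j => (1 : Module.End ℂ (X j))) i (S * T) =
      fun j => Function.update (fun j => (1 : Module.End ℂ (X j))) i S j *
        Function.update (fun j => (1 : Module.End ℂ (X j))) i T j := by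
    funext j
    by_cases h : j = i
    · subst h; simp
    · simp [h]
  have h2 := PiTensorProduct.map_mul (R := ℂ)
    (Function.update (fun j => (1 : Module.End ℂ (X j))) i S)
    (Function.update (fun j => (1 : Module.End ℂ (X j))) i T)
  rw [← key] at h2
  exact h2

theorem legMap_comm {i j : ι} (hij : i ≠ j) (S : Module.End ℂ (X i)) (T : Module.End ℂ (X j)) :
    legMap X i S * legMap X j T = legMap X j T * legMap X i S := by
  classical
  have key : (fun l => Function.update (fun j => (1 : Module.End ℂ (X j))) i S l *
        Function.update (fun j => (1 : Module.End ℂ (X j))) j T l) =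
      fun l => Function.update (fun j => (1 : Module.End ℂ (X j))) j T l *
        Function.update (fun j => (1 : Module.End ℂ (X j))) i S l := by
    funext l
    by_cases h : l = i
    · subst h; simp [hij]
    · by_cases h' : l = j
      · subst h'; simp [h]
      · simp [h, h']
  have h1 := PiTensorProduct.map_mul (R := ℂ)
    (Function.update (fun j => (1 : Module.End ℂ (X j))) i S)
    (Function.update (fun j => (1 : Module.End ℂ (X j))) j T)
  have h2 := PiTensorProduct.map_mul (R := ℂ)
    (Function.update (fun j => (1 : Module.End ℂ (X j))) j T)
    (Function.update (fun j => (1 : Module.End ℂ (X j))) i S)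
  rw [key, h2] at h1
  exact h1.symm

variable {g : Type*} [LieRing g] [LieAlgebra ℂ g] {c : ℂ}
variable [∀ i, LieRingModule (AffineAlgebra g c) (X i)] [∀ i, LieModule ℂ (AffineAlgebra g c) (X i)]

/-- `v₁ ⊗ ⋯ ⊗ v_l ↦ v₁ ⊗ ⋯ ⊗ Y v_i ⊗ ⋯ ⊗ v_l`. -/
def legOp (i : ι) : AffineAlgebra g c →ₗ[ℂ] Module.End ℂ (TensorModule X) :=
  legMap X i ∘ₗ (LieModule.toEnd ℂ (AffineAlgebra g c) (X i)).toLinearMap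

theorem legOp_lie (i : ι) (Y Z : AffineAlgebra g c) :
    legOp X i ⁅Y, Z⁆ = legOp X i Y * legOp X i Z - legOp X i Z * legOp X i Y := by
  simp only [legOp, LinearMap.comp_apply, LieHom.coe_toLinearMap, LieHom.map_lie,
    LieRing.of_associative_ring_bracket, map_sub, legMap_mul]

theorem legOp_comm {i j : ι} (hij : i ≠ j) (Y Z : AffineAlgebra g c) :
    legOp X i Y * legOp X j Z = legOp X j Z * legOp X i Y :=
  legMap_comm X hij _ _

variable [Fintype ι] (e : ι → (Laurent r →ₐ[ℂ] ℂ))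

/-- The action of `Y ⊗ t^m` on `X₁ ⊗ ⋯ ⊗ X_l`:
`v₁ ⊗ ⋯ ⊗ v_l ↦ ∑ i, e_i(t^m) v₁ ⊗ ⋯ ⊗ Y v_i ⊗ ⋯ ⊗ v_l`. -/
def evalOp (m : Fin r → ℤ) : AffineAlgebra g c →ₗ[ℂ] Module.End ℂ (TensorModule X) :=
  ∑ i, e i (mono m) • legOp X i

theorem evalOp_lie (m n : Fin r → ℤ) (Y Z : AffineAlgebra g c) :
    evalOp X e (m + n) ⁅Y, Z⁆ =
      evalOp X e m Y * evalOp X e n Z - evalOp X e n Z * evalOp X e m Y := by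
  have hmono : ∀ i, e i (mono (m + n)) = e i (mono m) * e i (mono n) := by
    intro i; rw [← map_mul]; simp [AddMonoidAlgebra.single_mul_single]
  simp only [evalOp, LinearMap.sum_apply, LinearMap.smul_apply, Finset.sum_mul_sum]
  rw [Finset.sum_comm (f := fun i j => (e i (mono n) • legOp X i Z) * (e j (mono m) • legOp X j Y)),
    ← Finset.sum_sub_distrib]
  refine Finset.sum_congr rfl fun i _ => ?_
  rw [← Finset.sum_sub_distrib, Finset.sum_eq_single i]
  · rw [legOp_lie, hmono, smul_mul_smul_comm, smul_mul_smul_comm, mul_comm (e i (mono n)), smul_sub]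
  · intro j _ hj
    rw [smul_mul_smul_comm, smul_mul_smul_comm, legOp_comm X hj, mul_comm (e i (mono m)), sub_self]
  · simp

/-- The action of `Y ⊗ t^m` on `L(X)`: `w ⊗ f ↦ (Y ⊗ t^m) w ⊗ t^m f`. -/
def currentOp (m : Fin r → ℤ) : AffineAlgebra g c →ₗ[ℂ] Module.End ℂ (LoopModule r X) where
  toFun Y := TensorProduct.map (evalOp X e m Y) (LinearMap.mulLeft ℂ (mono m))
  map_add' Y Z := by rw [map_add, TensorProduct.map_add_left]
  map_smul' s Y := by rw [map_smul, TensorProduct.map_smul_left]; rfl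

theorem currentOp_tmul (m : Fin r → ℤ) (Y : AffineAlgebra g c) (w : TensorModule X)
    (f : Laurent r) :
    currentOp X e m Y (w ⊗ₜ f) = evalOp X e m Y w ⊗ₜ (mono m * f) := rfl

theorem currentOp_lie (m n : Fin r → ℤ) (Y Z : AffineAlgebra g c) :
    currentOp X e (m + n) ⁅Y, Z⁆ =
      currentOp X e m Y * currentOp X e n Z - currentOp X e n Z * currentOp X e m Y := by
  apply TensorProduct.ext'
  intro w f
  have h1 : (mono (m + n) : Laurent r) * f = mono m * (mono n * f) := by
    rw [← mul_assoc]; simp [AddMonoidAlgebra.single_mul_single]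
  have h2 : (mono n : Laurent r) * (mono m * f) = mono m * (mono n * f) := mul_left_comm _ _ _
  simp only [LinearMap.sub_apply, Module.End.mul_apply, currentOp_tmul, evalOp_lie, h1, h2,
    TensorProduct.sub_tmul]


/-- `d_i` for `i ≥ 2` and `Y ⊗ t^m`. -/
theorem degreeOp_currentOp (u : Fin r → ℂ) (m : Fin r → ℤ) (Y : AffineAlgebra g c) :
    degreeOp X u * currentOp X e m Y - currentOp X e m Y * degreeOp X u =
      deg u m • currentOp X e m Y := by
  apply loopModule_hom_ext
  intro w n
  have h : (mono m : Laurent r) * mono n = mono (m + n) := by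
    simp [AddMonoidAlgebra.single_mul_single]
  simp only [LinearMap.sub_apply, Module.End.mul_apply, LinearMap.smul_apply, currentOp_tmul,
    degreeOp_tmul, map_smul, h, deg_add, add_smul, add_sub_cancel_right]

variable (g c) in
/-- `x ⊗ t^m = (x ⊗ t₁^{m₁}) ⊗ t₂^{m₂} ⋯ t_k^{m_k}` acts through `x ⊗ t₁^{m₁}`. -/
def repLoop : Loop g (r + 1) →ₗ[ℂ] Module.End ℂ (LoopModule r X) :=
  Finsupp.lsum ℂ fun m => currentOp (g := g) (c := c) X e (Fin.tail m) ∘ₗ loopEl (fun _ => m 0)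

variable (g c) in
/-- `t^m K₁` acts through `t₁^{m₁} K₁`, and `t^m K_j` acts by zero for `j ≥ 2`. -/
def repCen : Cen (r + 1) →ₗ[ℂ] Module.End ℂ (LoopModule r X) :=
  cenLift (fun m => currentOp (g := g) (c := c) X e (Fin.tail m) ∘ₗ cenEl (g := g) (c := c) (fun _ => m 0) ∘ₗ
      LinearMap.funLeft ℂ ℂ (fun _ : Fin 1 => (0 : Fin (r + 1)))) fun m => by
    exact (congrArg (currentOp (g := g) (c := c) X e (Fin.tail m))
      (cenEl_self (g := g) (c := c) (fun _ : Fin 1 => m 0))).trans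
      (map_zero (currentOp (g := g) (c := c) X e (Fin.tail m)))

variable (g c) in
/-- `d₁` acts by `d₁` on `X₁ ⊗ ⋯ ⊗ X_l`, and `d_i` by `w ⊗ f ↦ w ⊗ d_i f` for `i ≥ 2`. -/
def repDer : (Fin (r + 1) → ℂ) →ₗ[ℂ] Module.End ℂ (LoopModule r X) :=
  currentOp (g := g) (c := c) X e 0 ∘ₗ derEl (g := g) (c := c) ∘ₗ
      LinearMap.funLeft ℂ ℂ (fun _ : Fin 1 => (0 : Fin (r + 1))) +
    degreeOp X ∘ₗ LinearMap.funLeft ℂ ℂ Fin.succ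

@[simp] theorem repLoop_single (m : Fin (r + 1) → ℤ) (x : g) :
    repLoop X g c e (Finsupp.single m x) =
      currentOp (g := g) (c := c) X e (Fin.tail m) (loopEl (fun _ => m 0) x) := by
  simp [repLoop]

@[simp] theorem repCen_mk (m : Fin (r + 1) → ℤ) (w : Fin (r + 1) → ℂ) :
    repCen X g c e (cenMk m w) =
      currentOp (g := g) (c := c) X e (Fin.tail m) (cenEl (fun _ => m 0) (fun _ => w 0)) := by
  exact cenLift_mk _ _ m w

theorem repDer_apply (u : Fin (r + 1) → ℂ) :
    repDer X g c e u =
      currentOp (g := g) (c := c) X e 0 (derEl fun _ => u 0) + degreeOp X (Fin.tail u) := rfl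

theorem deg_succ (u : Fin (r + 1) → ℂ) (m : Fin (r + 1) → ℤ) :
    deg u m = deg (fun _ : Fin 1 => u 0) (fun _ => m 0) + deg (Fin.tail u) (Fin.tail m) := by
  simp [deg, Fin.sum_univ_succ, Fin.tail]

theorem repLoop_repLoop (a b : Loop g (r + 1)) :
    repLoop X g c e a * repLoop X g c e b - repLoop X g c e b * repLoop X g c e a =
      repLoop X g c e (loopBracket g (r + 1) a b) +
        repCen X g c e (cocycle g c (r + 1) a b) := by
  induction a using loop_ind with
  | h0 => simp
  | h2 a a' h h' =>
    simp only [map_add, LinearMap.add_apply, add_mul, mul_add]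
    rw [add_add_add_comm, ← h, ← h']; abel
  | h1 m x =>
    induction b using loop_ind with
    | h0 => simp
    | h2 a a' h h' =>
      simp only [map_add, add_mul, mul_add]
      rw [add_add_add_comm, ← h, ← h']; abel
    | h1 n y =>
      rw [loopBracket_single, cocycle_single, map_smul, repLoop_single, repLoop_single,
        repLoop_single, repCen_mk, ← currentOp_lie, lie_loopEl_loopEl, map_add, map_smul]
      rfl

theorem repCen_repLoop (a : Cen (r + 1)) (b : Loop g (r + 1)) :
    repCen X g c e a * repLoop X g c e b = repLoop X g c e b * repCen X g c e a := by
  induction a using cen_ind with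
  | h0 => simp
  | h2 a a' h h' => simp only [map_add, add_mul, mul_add, h, h']
  | h1 m w =>
    induction b using loop_ind with
    | h0 => simp
    | h2 a a' h h' => simp only [map_add, add_mul, mul_add, h, h']
    | h1 n y =>
      rw [repCen_mk, repLoop_single, ← sub_eq_zero, ← currentOp_lie, lie_cenEl_loopEl, map_zero]

theorem repCen_repCen (a b : Cen (r + 1)) :
    repCen X g c e a * repCen X g c e b = repCen X g c e b * repCen X g c e a := by
  induction a using cen_ind with
  | h0 => simp
  | h2 a a' h h' => simp only [map_add, add_mul, mul_add, h, h']
  | h1 m w =>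
    induction b using cen_ind with
    | h0 => simp
    | h2 a a' h h' => simp only [map_add, add_mul, mul_add, h, h']
    | h1 n y =>
      rw [repCen_mk, repCen_mk, ← sub_eq_zero, ← currentOp_lie, lie_cenEl_cenEl, map_zero]

theorem repDer_current (u : Fin (r + 1) → ℂ) (m : Fin (r + 1) → ℤ) (Y : AffineAlgebra g c)
    (hY : ⁅(derEl (fun _ => u 0) : AffineAlgebra g c), Y⁆ =
      deg (fun _ : Fin 1 => u 0) (fun _ => m 0) • Y) :
    repDer X g c e u * currentOp X e (Fin.tail m) Y -
      currentOp X e (Fin.tail m) Y * repDer X g c e u =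
      deg u m • currentOp X e (Fin.tail m) Y := by
  rw [repDer_apply, add_mul, mul_add, add_sub_add_comm, degreeOp_currentOp, ← currentOp_lie, hY,
    zero_add, map_smul, ← add_smul, ← deg_succ]

theorem repDer_repLoop (u : Fin (r + 1) → ℂ) (b : Loop g (r + 1)) :
    repDer X g c e u * repLoop X g c e b - repLoop X g c e b * repDer X g c e u =
      repLoop X g c e (loopDer u b) := by
  induction b using loop_ind with
  | h0 => simp
  | h2 a a' h h' => simp only [map_add, add_mul, mul_add]; rw [← h, ← h']; abel
  | h1 n y =>
    rw [loopDer_single, map_smul, repLoop_single]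
    exact repDer_current X e u n _ (lie_derEl_loopEl _ _ _)

theorem repDer_repCen (u : Fin (r + 1) → ℂ) (b : Cen (r + 1)) :
    repDer X g c e u * repCen X g c e b - repCen X g c e b * repDer X g c e u =
      repCen X g c e (cenDer u b) := by
  induction b using cen_ind with
  | h0 => simp
  | h2 a a' h h' => simp only [map_add, add_mul, mul_add]; rw [← h, ← h']; abel
  | h1 n y =>
    rw [cenDer_mk, map_smul, repCen_mk]
    exact repDer_current X e u n _ (lie_derEl_cenEl _ _ _)

theorem repDer_repDer (u v : Fin (r + 1) → ℂ) :
    repDer X g c e u * repDer X g c e v = repDer X g c e v * repDer X g c e u := by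
  have h1 := currentOp_lie X e 0 0 (derEl (fun _ => u 0) : AffineAlgebra g c)
    (derEl fun _ => v 0)
  rw [lie_derEl_derEl, map_zero] at h1
  replace h1 := (sub_eq_zero (G := Module.End ℂ (LoopModule r X))).mp h1.symm
  have hz : ∀ w : Fin r → ℂ, deg w 0 = 0 := fun w => by simp [deg]
  have h2 := degreeOp_currentOp X e (Fin.tail u) 0 (derEl (fun _ => v 0) : AffineAlgebra g c)
  rw [hz, zero_smul] at h2
  replace h2 := (sub_eq_zero (G := Module.End ℂ (LoopModule r X))).mp h2
  have h3 := degreeOp_currentOp X e (Fin.tail v) 0 (derEl (fun _ => u 0) : AffineAlgebra g c)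
  rw [hz, zero_smul] at h3
  replace h3 := (sub_eq_zero (G := Module.End ℂ (LoopModule r X))).mp h3
  have h4 : degreeOp X (Fin.tail u) * degreeOp X (Fin.tail v) =
      degreeOp X (Fin.tail v) * degreeOp X (Fin.tail u) := by
    apply loopModule_hom_ext
    intro w n
    simp only [Module.End.mul_apply, degreeOp_tmul, map_smul, smul_smul, mul_comm]
  simp only [repDer_apply, add_mul, mul_add, h1, h2, h3, h4]
  abel

variable (g c) in
/-- The `𝒯(g)`-module `L(X₁ ⊗ ⋯ ⊗ X_l)` attached to modules `X_i` of the affine algebra and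
evaluation homomorphisms `e_i`. -/
def loopModuleRep : ToroidalAlgebra g c (r + 1) →ₗ⁅ℂ⁆ Module.End ℂ (LoopModule r X) where
  toFun Y := repLoop X g c e Y.loop + repCen X g c e Y.cen + repDer X g c e Y.der
  map_add' Y Z := by simp only [add_loop, add_cen, add_der, map_add]; abel
  map_smul' s Y := by
    simp only [smul_loop, smul_cen, smul_der, map_smul, smul_add, RingHom.id_apply]
  map_lie' {Y Z} := by
    rw [LieRing.of_associative_ring_bracket]
    simp only [lie_loop, lie_cen, lie_der, map_add, map_sub, map_zero, add_zero]
    rw [← repDer_repLoop, ← repDer_repLoop, ← repDer_repCen, ← repDer_repCen]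
    have h1 := repLoop_repLoop (c := c) X e Y.loop Z.loop
    have h2 := repCen_repLoop (c := c) X e Y.cen Z.loop
    have h3 := repCen_repLoop (c := c) X e Z.cen Y.loop
    have h4 := repCen_repCen (g := g) (c := c) X e Y.cen Z.cen
    have h5 := repDer_repDer (g := g) (c := c) X e Y.der Z.der
    rw [eq_comm, ← eq_sub_iff_add_eq] at h1
    rw [h1]
    simp only [add_mul, mul_add, h2, h3, h4, h5]
    abel

end Evaluation

/-! ### Evaluation at maximal ideals -/

theorem algebraMap_quotient_bijective {r : ℕ} (M : MaximalSpectrum (Laurent r)) :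
    Function.Bijective (algebraMap ℂ (Laurent r ⧸ M.asIdeal)) := by
  have hM := M.isMaximal
  let _ : Field (Laurent r ⧸ M.asIdeal) := Ideal.Quotient.field M.asIdeal
  have h1 : Algebra.FiniteType ℂ (Laurent r) := inferInstance
  have h2 : Algebra.FiniteType ℂ (Laurent r ⧸ M.asIdeal) :=
    h1.of_surjective (Ideal.Quotient.mkₐ ℂ M.asIdeal) (Ideal.Quotient.mkₐ_surjective ℂ M.asIdeal)
  have h3 : Module.Finite ℂ (Laurent r ⧸ M.asIdeal) :=
    finite_of_finite_type_of_isJacobsonRing ℂ (Laurent r ⧸ M.asIdeal)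
  exact IsAlgClosed.algebraMap_bijective_of_isIntegral

/-- The evaluation homomorphism `A → A / M = ℂ` at a maximal ideal `M`. -/
def evAt {r : ℕ} (M : MaximalSpectrum (Laurent r)) : Laurent r →ₐ[ℂ] ℂ :=
  (AlgEquiv.ofBijective (Algebra.ofId ℂ (Laurent r ⧸ M.asIdeal))
    (algebraMap_quotient_bijective M)).symm.toAlgHom.comp (Ideal.Quotient.mkₐ ℂ M.asIdeal)

/-! ### The affine Cartan subalgebra and dominant integral weights -/

section Cartan

open LieAlgebra.IsKilling

variable {g : Type*} [LieRing g] [LieAlgebra ℂ g] [FiniteDimensional ℂ g]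
  [LieAlgebra.IsSimple ℂ g] (H : LieSubalgebra ℂ g) [H.IsCartanSubalgebra]

/-- `θ` is the highest root: `θ - β` is a sum of simple roots for every root `β`. -/
def IsHighestRoot (b : (rootSystem H).Base) (θ : H.root) : Prop :=
  ∀ β : H.root, (rootSystem H).root θ - (rootSystem H).root β ∈
    AddSubmonoid.closure ((rootSystem H).root '' b.support)

/-- The factor `c` for which `(x|y) = c * κ(x, y)` has `(θ^∨|θ^∨) = 2`, that is, `(θ|θ) = 2`. -/
def normScale (θ : H.root) : ℂ :=
  2 / killingForm ℂ g ((rootSystem H).coroot θ : H) ((rootSystem H).coroot θ : H)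

/-- The affine Cartan subalgebra `h_aff = h ⊕ ℂK₁ ⊕ ℂd₁`, as the space of triples
`(h, a, d)` standing for `h + a K₁ + d d₁`. -/
abbrev CartanAff : Type _ := H × ℂ × ℂ

variable {H} in
/-- The inclusion of `h_aff` into the affine algebra. -/
def cartanAff {c : ℂ} : CartanAff H →ₗ[ℂ] AffineAlgebra g c :=
  LinearMap.coprod (loopEl 0 ∘ₗ H.toSubmodule.subtype)
    (LinearMap.coprod (cenEl 0 ∘ₗ LinearMap.toSpanSingleton ℂ _ fun _ => 1)
      (derEl ∘ₗ LinearMap.toSpanSingleton ℂ _ fun _ => 1))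

variable {H}

/-- The simple coroots of the affine algebra: `α_i^∨` for the simple roots `α_i` of `g`, and
`α_{n+1}^∨ = K₁ - θ^∨`. -/
def affCoroot (b : (rootSystem H).Base) (θ : H.root) : Option b.support → CartanAff H
  | some i => ((rootSystem H).coroot i, 0, 0)
  | none => (-(rootSystem H).coroot θ, 1, 0)

/-- The dominant integral weights `P⁺_aff = {λ ∈ h_aff^* | λ(α_i^∨) ∈ ℤ₊ for i = 1,…,n+1}`. -/
def PaffPlus (b : (rootSystem H).Base) (θ : H.root) :
    AddSubmonoid (Module.Dual ℂ (CartanAff H)) where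
  carrier := {lam | ∀ i, ∃ n : ℕ, lam (affCoroot b θ i) = n}
  zero_mem' i := ⟨0, by simp⟩
  add_mem' {lam mu} hl hm i := by
    obtain ⟨n, hn⟩ := hl i
    obtain ⟨p, hp⟩ := hm i
    exact ⟨n + p, by simp [hn, hp]⟩

/-- The spanning set of `n_aff^+ = n^+ ⊕ g ⊗ t₁ℂ[t₁]`. -/
def nAffPlus (b : (rootSystem H).Base) (c : ℂ) : Set (AffineAlgebra g c) :=
  {Y | ∃ α : H.root, b.IsPos α ∧ ∃ x ∈ LieAlgebra.rootSpace H α.1, Y = loopEl 0 x} ∪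
    {Y | ∃ m : ℕ, 0 < m ∧ ∃ x : g, Y = loopEl (fun _ => (m : ℤ)) x}

/-- `X` is the irreducible highest weight module `X(Λ)` of the affine algebra, and `v` is a
highest weight vector of it. -/
structure IsHighestWeightModule (b : (rootSystem H).Base) {c : ℂ}
    (Lam : Module.Dual ℂ (CartanAff H)) (X : Type*) [AddCommGroup X] [Module ℂ X]
    [LieRingModule (AffineAlgebra g c) X] [LieModule ℂ (AffineAlgebra g c) X] (v : X) : Prop where
  irreducible : LieModule.IsIrreducible ℂ (AffineAlgebra g c) X
  ne_zero : v ≠ 0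
  raise : ∀ Y ∈ nAffPlus b c, ⁅Y, v⁆ = 0
  weight : ∀ h : CartanAff H, ⁅(cartanAff h : AffineAlgebra g c), v⁆ = Lam h • v

/-! ### The ring `A_Λ` -/

/-- The monomial exponent `(0, m)`, i.e. `t₂^{m₂} ⋯ t_k^{m_k}`. -/
def tailExp {r : ℕ} (m : Fin r → ℤ) : Fin (r + 1) → ℤ := Fin.cons 0 m

/-- `(h + a K₁) ⊗ t^m` with `m ∈ ℤ^{k-1}`, as an element of `𝒯(g)`. -/
def cartanCurrent {c : ℂ} {r : ℕ} (m : Fin r → ℤ) (h : H) (a : ℂ) :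
    ToroidalAlgebra g c (r + 1) :=
  loopEl (tailExp m) (h : g) + cenEl (tailExp m) (Pi.single 0 a)

variable (H) in
/-- The Lie subalgebra of `𝒯(g)` spanned by the `h ⊗ t^m`, the `t^m K_i` and `d₁`, where
`h ∈ H`, `m ∈ ℤ^{k-1}` and `1 ≤ i ≤ k`. -/
def cartanLoop (c : ℂ) (r : ℕ) : LieSubalgebra ℂ (ToroidalAlgebra g c (r + 1)) :=
  LieSubalgebra.lieSpan ℂ _
    ({Y | ∃ (m : Fin r → ℤ) (h : H), Y = loopEl (tailExp m) (h : g)} ∪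
      {Y | ∃ (m : Fin r → ℤ) (w : Fin (r + 1) → ℂ), Y = cenEl (tailExp m) w} ∪
      {derEl (Pi.single 0 1)})

theorem loopEl_mem_cartanLoop {c : ℂ} {r : ℕ} (m : Fin r → ℤ) (h : H) :
    (loopEl (tailExp m) (h : g) : ToroidalAlgebra g c (r + 1)) ∈ cartanLoop H c r :=
  LieSubalgebra.subset_lieSpan (Or.inl (Or.inl ⟨m, h, rfl⟩))

theorem cenEl_mem_cartanLoop {c : ℂ} {r : ℕ} (m : Fin r → ℤ) (w : Fin (r + 1) → ℂ) :
    (cenEl (tailExp m) w : ToroidalAlgebra g c (r + 1)) ∈ cartanLoop H c r :=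
  LieSubalgebra.subset_lieSpan (Or.inl (Or.inr ⟨m, w, rfl⟩))

theorem derEl_mem_cartanLoop {c : ℂ} {r : ℕ} :
    (derEl (Pi.single 0 1) : ToroidalAlgebra g c (r + 1)) ∈ cartanLoop H c r :=
  LieSubalgebra.subset_lieSpan (Or.inr rfl)

variable (H) in
/-- The enveloping algebra in which the relations of `A_Λ` are imposed. -/
abbrev UCartan (c : ℂ) (r : ℕ) : Type _ := UniversalEnvelopingAlgebra ℂ (cartanLoop H c r)

/-- `(h + a K₁) ⊗ t^m` in the enveloping algebra. -/
def uCurrent {c : ℂ} {r : ℕ} (m : Fin r → ℤ) (h : H) (a : ℂ) : UCartan H c r :=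
  UniversalEnvelopingAlgebra.ι ℂ
    ⟨cartanCurrent m h a, add_mem (loopEl_mem_cartanLoop m h) (cenEl_mem_cartanLoop m _)⟩

/-- `t^m K_j` in the enveloping algebra. -/
def uCentral {c : ℂ} {r : ℕ} (m : Fin r → ℤ) (j : Fin (r + 1)) : UCartan H c r :=
  UniversalEnvelopingAlgebra.ι ℂ ⟨cenEl (tailExp m) (Pi.single j 1), cenEl_mem_cartanLoop m _⟩

/-- `h ∈ h_aff` in the enveloping algebra. -/
def uCartan {c : ℂ} {r : ℕ} (h : CartanAff H) : UCartan H c r :=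
  uCurrent 0 h.1 h.2.1 + h.2.2 • UniversalEnvelopingAlgebra.ι ℂ
    ⟨derEl (Pi.single 0 1), derEl_mem_cartanLoop⟩

/-- `-∑_{q ≥ 1} (α^∨ ⊗ a^q) u^q / q` for `a = t^m` and the affine simple coroot `α^∨`. -/
def logSeries {c : ℂ} {r : ℕ} (b : (rootSystem H).Base) (θ : H.root) (i : Option b.support)
    (m : Fin r → ℤ) : PowerSeries (UCartan H c r) :=
  PowerSeries.mk fun q => if q = 0 then 0 else
    (-(q : ℂ)⁻¹) • uCurrent (q • m) (affCoroot b θ i).1 (affCoroot b θ i).2.1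

/-- `p^s_{α,a}`, the coefficient of `u^s` in `exp (-∑_{q ≥ 1} (α^∨ ⊗ a^q) u^q / q)`, where
`a = t^m`. The exponential series may be cut off after the `s`-th term. -/
def pCoeff {c : ℂ} {r : ℕ} (b : (rootSystem H).Base) (θ : H.root) (i : Option b.support)
    (m : Fin r → ℤ) (s : ℕ) : UCartan H c r :=
  ∑ n ∈ Finset.range (s + 1),
    ((n.factorial : ℂ)⁻¹) • PowerSeries.coeff s (logSeries b θ i m ^ n)

/-- The generators of the ideal `I_Λ`: `h - Λ(h)` for `h ∈ h_aff`, `t^m K_j` for `j ≥ 2`, and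
`p^s_{α_i,a}` and `∑_{l=0}^s (α_i^∨ ⊗ a^{s-l}) p^l_{α_i,a}` for `s > Λ(α_i^∨)` and monomials `a`. -/
inductive RelGen (c : ℂ) (r : ℕ) (b : (rootSystem H).Base) (θ : H.root)
    (Lam : Module.Dual ℂ (CartanAff H)) : UCartan H c r → Prop
  | cartan (h : CartanAff H) : RelGen c r b θ Lam (uCartan h - algebraMap ℂ _ (Lam h))
  | central (m : Fin r → ℤ) (j : Fin r) : RelGen c r b θ Lam (uCentral m j.succ)
  | coeff (i : Option b.support) (m : Fin r → ℤ) (n s : ℕ) (hn : Lam (affCoroot b θ i) = n)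
      (hs : n < s) : RelGen c r b θ Lam (pCoeff b θ i m s)
  | sum (i : Option b.support) (m : Fin r → ℤ) (n s : ℕ) (hn : Lam (affCoroot b θ i) = n)
      (hs : n < s) : RelGen c r b θ Lam (∑ l ∈ Finset.range (s + 1),
        uCurrent ((s - l) • m) (affCoroot b θ i).1 (affCoroot b θ i).2.1 * pCoeff b θ i m l)

/-- The two-sided ideal `I_Λ`. -/
def relIdeal (c : ℂ) (r : ℕ) (b : (rootSystem H).Base) (θ : H.root)
    (Lam : Module.Dual ℂ (CartanAff H)) : TwoSidedIdeal (UCartan H c r) :=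
  TwoSidedIdeal.span {u | RelGen c r b θ Lam u}

/-- The ring `A_Λ`. -/
abbrev ALam (c : ℂ) (r : ℕ) (b : (rootSystem H).Base) (θ : H.root)
    (Lam : Module.Dual ℂ (CartanAff H)) : Type _ :=
  (relIdeal c r b θ Lam).ringCon.Quotient

/-! ### The module `L(X_π)` and the degrees of `A_Λ v_π` -/

/-- The weight `wt π = ∑_M π(M)`. -/
def wt {r : ℕ} {b : (rootSystem H).Base} {θ : H.root}
    (π : MaximalSpectrum (Laurent r) →₀ PaffPlus b θ) : Module.Dual ℂ (CartanAff H) :=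
  π.sum fun _ lam => lam

end Cartan

section Degrees

variable {r : ℕ} {ι : Type*} (X : ι → Type*) [∀ i, AddCommGroup (X i)] [∀ i, Module ℂ (X i)]

/-- `v_π ⊗ 1`, where `v_π` is the tensor product of the vectors `v i`. -/
def cyclicVec (r : ℕ) (v : ∀ i, X i) : LoopModule r X := pureTensor X v ⊗ₜ 1

variable {X} in
/-- The subspace `𝒜 v` for an algebra `𝒜` of operators. -/
def orbit (𝒜 : Subalgebra ℂ (Module.End ℂ (LoopModule r X))) (v : LoopModule r X) :
    Submodule ℂ (LoopModule r X) :=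
  (Subalgebra.toSubmodule 𝒜).map (LinearMap.applyₗ v)

variable {X} in
/-- The degrees `m` for which the component `N ∩ (X ⊗ t^m)` of `N` is nonzero. -/
def degreeSet (N : Submodule ℂ (LoopModule r X)) : Set (Fin r → ℤ) :=
  {m | ∃ w : TensorModule X, w ⊗ₜ mono m ∈ N ∧ w ⊗ₜ mono m ≠ (0 : LoopModule r X)}

variable {g : Type*} [LieRing g] [LieAlgebra ℂ g] [FiniteDimensional ℂ g]
  [LieAlgebra.IsSimple ℂ g] (H : LieSubalgebra ℂ g) [H.IsCartanSubalgebra] (c : ℂ)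
  [∀ i, LieRingModule (AffineAlgebra g c) (X i)] [∀ i, LieModule ℂ (AffineAlgebra g c) (X i)]
  [Fintype ι] (e : ι → (Laurent r →ₐ[ℂ] ℂ))

/-- The action of the enveloping algebra on `L(X)`. -/
def uAct : UCartan H c r →ₐ[ℂ] Module.End ℂ (LoopModule r X) :=
  UniversalEnvelopingAlgebra.lift ℂ ((loopModuleRep X g c e).comp (cartanLoop H c r).incl)

/-- The algebra of operators on `L(X)` generated by all `Y ⊗ t^m` with `Y ∈ h_aff`, including
`d₁ ⊗ t^m`, and `m ∈ ℤ^{k-1}`. -/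
def fullCartanOps : Subalgebra ℂ (Module.End ℂ (LoopModule r X)) :=
  Algebra.adjoin ℂ {T | ∃ (m : Fin r → ℤ) (h : CartanAff H),
    T = currentOp X e m (cartanAff h : AffineAlgebra g c)}

end Degrees

end Toroidal

end

open ToroidalAlgebra

noncomputable section

attribute [local instance 100] LieRing.ofAssociativeRing

namespace Toroidal

section ExponentialSeries

open PowerSeries

variable {R : Type*} [CommRing R]

theorem coeff_pow_eq_zero_of_lt {L : PowerSeries R} (hL : constantCoeff L = 0) {s n : ℕ}
    (h : s < n) : coeff s (L ^ n) = 0 := by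
  obtain ⟨K, rfl⟩ := X_dvd_iff.mpr hL
  rw [mul_pow, coeff_X_pow_mul', if_neg (by omega)]

theorem derivative_one_sub_pow (y : R) (n : ℕ) :
    derivative R ((1 - C y * X) ^ n) =
      mk (fun q => -(n • y ^ (q + 1))) * (1 - C y * X) ^ n := by
  have h1 : mk (fun q => y ^ q) * (1 - C y * X) = 1 := by
    ext s
    cases s with
    | zero => simp [mul_sub]
    | succ s =>
      rw [mul_sub, mul_one, map_sub, ← mul_assoc, coeff_succ_mul_X, mul_comm _ (C y),
        coeff_C_mul]
      simp [coeff_one, pow_succ']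
  have h2 : mk (fun q => -(n • y ^ (q + 1))) = -(n : R⟦X⟧) * C y * mk (fun q => y ^ q) := by
    ext s
    rw [show -(n : R⟦X⟧) * C y * mk (fun q => y ^ q) =
      C (-(n : R) * y) * mk (fun q => y ^ q) by simp, coeff_C_mul]
    simp [pow_succ']; ring
  cases n with
  | zero =>
    have : (mk fun _ => 0 : R⟦X⟧) = 0 := by ext; simp
    simp [this]
  | succ n =>
    rw [h2, derivative_pow, add_tsub_cancel_right, pow_succ', map_sub, Derivation.leibniz]
    simp only [Derivation.map_one_eq_zero, derivative_C, derivative_X, smul_eq_mul]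
    linear_combination (-((n + 1 : ℕ) : R⟦X⟧)) * C y * (1 - C y * X) ^ n * (-h1)

theorem derivative_prod_eq_mul {ι : Type*} (s : Finset ι) (P D : ι → PowerSeries R)
    (h : ∀ i, derivative R (P i) = D i * P i) :
    derivative R (∏ i ∈ s, P i) = (∑ i ∈ s, D i) * ∏ i ∈ s, P i := by
  classical
  induction s using Finset.induction_on with
  | empty => simp
  | insert i s hi ih =>
    rw [Finset.prod_insert hi, Finset.sum_insert hi, Derivation.leibniz, ih, h]
    simp only [smul_eq_mul]
    ring

variable [Algebra ℂ R]

/-- The coefficient of `u^s` in `exp L`, for a power series `L` without constant term. -/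
def expCoeff (L : PowerSeries R) (s : ℕ) : R :=
  ∑ n ∈ Finset.range (s + 1), ((n.factorial : ℂ)⁻¹) • coeff s (L ^ n)

theorem expCoeff_eq_sum {L : PowerSeries R} (hL : constantCoeff L = 0) {s N : ℕ} (h : s ≤ N) :
    expCoeff L s = ∑ n ∈ Finset.range (N + 1), ((n.factorial : ℂ)⁻¹) • coeff s (L ^ n) := by
  refine Finset.sum_subset (Finset.range_mono (by omega)) fun n _ hn => ?_
  rw [coeff_pow_eq_zero_of_lt hL (by simpa using hn), smul_zero]

theorem derivative_expCoeff {L : PowerSeries R} (hL : constantCoeff L = 0) :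
    derivative R (mk (expCoeff L)) = derivative R L * mk (expCoeff L) := by
  ext s
  rw [coeff_derivative, coeff_mk, expCoeff, Finset.sum_mul, Finset.sum_range_succ', coeff_mul]
  have h0 : coeff (s + 1) (L ^ 0) = 0 := by simp [coeff_one]
  rw [h0, smul_zero, zero_mul, add_zero]
  have h1 : ∀ p ∈ Finset.HasAntidiagonal.antidiagonal s,
      coeff p.1 (derivative R L) * coeff p.2 (mk (expCoeff L)) =
        ∑ n ∈ Finset.range (s + 1),
          ((n.factorial : ℂ)⁻¹) • (coeff p.1 (derivative R L) * coeff p.2 (L ^ n)) := by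
    intro p hp
    rw [coeff_mk, expCoeff_eq_sum hL (by rw [Finset.HasAntidiagonal.mem_antidiagonal] at hp; omega : p.2 ≤ s), Finset.mul_sum]
    simp only [mul_smul_comm]
  rw [Finset.sum_congr rfl h1, Finset.sum_comm]
  refine Finset.sum_congr rfl fun n _ => ?_
  rw [← Finset.smul_sum, ← coeff_mul, smul_mul_assoc]
  have h2 : coeff (s + 1) (L ^ (n + 1)) * ((s : R) + 1) =
      ((n : ℂ) + 1) • coeff s (derivative R L * L ^ n) := by
    rw [← coeff_derivative, derivative_pow, Algebra.smul_def, add_tsub_cancel_right,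
      show ((n + 1 : ℕ) : R⟦X⟧) * L ^ n * derivative R L =
        C (algebraMap ℂ R ((n : ℂ) + 1)) * (derivative R L * L ^ n) by
          simp only [Nat.cast_add, Nat.cast_one, map_add, map_natCast, map_one]; ring,
      coeff_C_mul]
  rw [h2, smul_smul]
  congr 1
  have : (n.factorial : ℂ) ≠ 0 := by exact_mod_cast n.factorial_ne_zero
  have : (n : ℂ) + 1 ≠ 0 := by exact_mod_cast n.succ_ne_zero
  rw [Nat.factorial_succ]
  push_cast
  field_simp

theorem eq_of_derivative_eq_mul {E P D : PowerSeries R} (hE : derivative R E = D * E)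
    (hP : derivative R P = D * P) (h0 : constantCoeff E = constantCoeff P) : E = P := by
  ext s
  induction s using Nat.strong_induction_on with
  | _ s ih =>
    cases s with
    | zero => simpa using h0
    | succ s =>
      have h : coeff s (derivative R E) = coeff s (derivative R P) := by
        rw [hE, hP, coeff_mul, coeff_mul]
        refine Finset.sum_congr rfl fun p hp => ?_
        rw [ih p.2 (by rw [Finset.HasAntidiagonal.mem_antidiagonal] at hp; omega)]
      rw [coeff_derivative, coeff_derivative] at h
      have hs : ((s : ℂ) + 1) ≠ 0 := by exact_mod_cast s.succ_ne_zero
      have hu : IsUnit ((s : R) + 1) := by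
        have := (IsUnit.mk0 _ hs).map (algebraMap ℂ R)
        simpa using this
      exact hu.mul_right_cancel h

variable {ι : Type*} [Fintype ι] {y : ι → R} {n : ι → ℕ} {L : PowerSeries R}

/-- `exp (-∑_q (∑_i n_i y_i^q) u^q / q) = ∏_i (1 - y_i u)^{n_i}`. -/
theorem mk_expCoeff_eq_prod
    (hL : ∀ q, coeff q L = if q = 0 then 0 else (-(q : ℂ)⁻¹) • ∑ i, n i • y i ^ q) :
    mk (expCoeff L) = ∏ i, (1 - C (y i) * X) ^ n i := by
  have h0 : constantCoeff L = 0 := by simpa using hL 0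
  refine eq_of_derivative_eq_mul (D := derivative R L) (derivative_expCoeff h0) ?_ ?_
  · rw [derivative_prod_eq_mul _ _ _ fun i => derivative_one_sub_pow (y i) (n i)]
    congr 1
    ext s
    rw [coeff_derivative, hL, if_neg s.succ_ne_zero, map_sum, Algebra.smul_def, mul_right_comm]
    have hs : ((s : ℂ) + 1) ≠ 0 := by exact_mod_cast s.succ_ne_zero
    have : algebraMap ℂ R (-((s + 1 : ℕ) : ℂ)⁻¹) * ((s : R) + 1) = -1 := by
      rw [show ((s : R) + 1) = algebraMap ℂ R ((s : ℂ) + 1) by simp, ← map_mul]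
      rw [Nat.cast_add, Nat.cast_one, neg_mul, inv_mul_cancel₀ hs, map_neg, map_one]
    rw [this]
    simp
  · rw [← coeff_zero_eq_constantCoeff_apply, coeff_mk]
    simp [expCoeff]

theorem expCoeff_eq_zero
    (hL : ∀ q, coeff q L = if q = 0 then 0 else (-(q : ℂ)⁻¹) • ∑ i, n i • y i ^ q)
    {s : ℕ} (hs : ∑ i, n i < s) : expCoeff L s = 0 := by
  have h1 : expCoeff L s = coeff s (∏ i, (1 - C (y i) * X) ^ n i) := by
    rw [← mk_expCoeff_eq_prod hL, coeff_mk]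
  have h2 : (∏ i, (1 - C (y i) * X) ^ n i : R⟦X⟧) =
      ((∏ i, (1 - Polynomial.C (y i) * Polynomial.X) ^ n i : Polynomial R) : R⟦X⟧) := by
    rw [← Polynomial.coeToPowerSeries.ringHom_apply, map_prod]
    simp
  rw [h1, h2, Polynomial.coeff_coe]
  refine Polynomial.coeff_eq_zero_of_natDegree_lt (lt_of_le_of_lt ?_ hs)
  refine (Polynomial.natDegree_prod_le _ _).trans (Finset.sum_le_sum fun i _ => ?_)
  refine (Polynomial.natDegree_pow_le).trans ?_
  have : (1 - Polynomial.C (y i) * Polynomial.X).natDegree ≤ 1 := by compute_degree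
  simpa using Nat.mul_le_mul_left (n i) this

theorem sum_mul_expCoeff_eq_zero
    (hL : ∀ q, coeff q L = if q = 0 then 0 else (-(q : ℂ)⁻¹) • ∑ i, n i • y i ^ q)
    {s : ℕ} (hs : ∑ i, n i < s) :
    ∑ l ∈ Finset.range (s + 1), (∑ i, n i • y i ^ (s - l)) * expCoeff L l = 0 := by
  obtain ⟨t, rfl⟩ : ∃ t, s = t + 1 := ⟨s - 1, by omega⟩
  have h0 : constantCoeff L = 0 := by simpa using hL 0
  rw [Finset.sum_range_succ, expCoeff_eq_zero hL hs, mul_zero, add_zero]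
  have h1 := congrArg (coeff t) (derivative_expCoeff h0)
  rw [coeff_derivative, coeff_mk, expCoeff_eq_zero hL hs, zero_mul, mul_comm (derivative R L),
    coeff_mul, Finset.Nat.sum_antidiagonal_eq_sum_range_succ_mk] at h1
  rw [← neg_eq_zero, ← Finset.sum_neg_distrib, h1]
  refine Finset.sum_congr rfl fun l hl => ?_
  have hl' : l ≤ t := by simpa [Nat.lt_succ_iff] using hl
  have hs : ((t - l : ℕ) : ℂ) + 1 ≠ 0 := by exact_mod_cast (t - l).succ_ne_zero
  rw [coeff_mk, mul_comm _ (expCoeff L l), neg_mul_eq_mul_neg, coeff_derivative, hL,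
    if_neg (t - l).succ_ne_zero, Algebra.smul_def, mul_right_comm,
    show (((t - l : ℕ) : R) + 1) = algebraMap ℂ R (((t - l : ℕ) : ℂ) + 1) by simp, ← map_mul]
  rw [Nat.cast_add, Nat.cast_one, neg_mul, inv_mul_cancel₀ hs, map_neg, map_one, neg_one_mul,
    Nat.sub_add_comm hl']

end ExponentialSeries

section ExponentialSums

theorem exists_pos_sum_mul_pow_ne_zero {ι K : Type*} [Fintype ι] [Field K] (c z : ι → K)
    (hz : ∀ i, z i ≠ 0) (h : ∑ i, c i ≠ 0) : ∃ q : ℕ, 0 < q ∧ ∑ i, c i * z i ^ q ≠ 0 := by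
  by_contra! hq
  let P : Polynomial K := ∏ i, (Polynomial.X - Polynomial.C (z i))
  have h1 : ∑ i, c i * P.eval (z i) = 0 := Finset.sum_eq_zero fun i _ => by
    rw [Polynomial.eval_prod, Finset.prod_eq_zero (Finset.mem_univ i) (by simp), mul_zero]
  have h2 : ∑ i, c i * P.eval (z i) = P.coeff 0 * ∑ i, c i := by
    simp only [Polynomial.eval_eq_sum_range, Finset.mul_sum]
    rw [Finset.sum_comm, Finset.sum_range_succ', Finset.sum_eq_zero, zero_add]
    · exact Finset.sum_congr rfl fun i _ => by rw [pow_zero]; ring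
    · intro q _
      rw [← mul_zero (P.coeff (q + 1)), ← hq (q + 1) q.succ_pos, Finset.mul_sum]
      exact Finset.sum_congr rfl fun i _ => by ring
  have h3 : P.coeff 0 ≠ 0 := by
    rw [Polynomial.coeff_zero_eq_eval_zero, Polynomial.eval_prod, Finset.prod_ne_zero_iff]
    simpa using hz
  exact mul_ne_zero h3 h (h2.symm.trans h1)

theorem hom_mono_ne_zero {r : ℕ} (e : Laurent r →ₐ[ℂ] ℂ) (m : Fin r → ℤ) : e (mono m) ≠ 0 := by
  intro h
  have h1 : e (mono m) * e (mono (-m)) = 1 := by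
    rw [← map_mul, AddMonoidAlgebra.single_mul_single, add_neg_cancel, one_mul]
    exact map_one e
  rw [h, zero_mul] at h1
  exact zero_ne_one h1

theorem mono_add {r : ℕ} (m n : Fin r → ℤ) : (mono (m + n) : Laurent r) = mono m * mono n := by
  rw [AddMonoidAlgebra.single_mul_single, one_mul]

theorem mono_nsmul {r : ℕ} (q : ℕ) (m : Fin r → ℤ) :
    (mono (q • m) : Laurent r) = mono m ^ q := by
  rw [AddMonoidAlgebra.single_pow, one_pow]

variable {r : ℕ} {ι : Type*} [Fintype ι] (e : ι → (Laurent r →ₐ[ℂ] ℂ))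

/-- The exponential sum `m ↦ ∑ i, c i * e_i(t^m)`. -/
def expSum (c : ι → ℂ) (m : Fin r → ℤ) : ℂ := ∑ i, c i * e i (mono m)

theorem exists_pos_expSum_ne_zero (c : ι → ℂ) {m : Fin r → ℤ} (n : Fin r → ℤ)
    (h : expSum e c m ≠ 0) : ∃ q : ℕ, 0 < q ∧ expSum e c (m + q • n) ≠ 0 := by
  obtain ⟨q, hq, hne⟩ := exists_pos_sum_mul_pow_ne_zero (fun i => c i * e i (mono m))
    (fun i => e i (mono n)) (fun i => hom_mono_ne_zero (e i) n) h
  refine ⟨q, hq, ?_⟩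
  simpa only [expSum, mono_add, mono_nsmul, map_mul, map_pow, mul_assoc] using hne

/-- A nonzero combination of distinct characters of `ℤ^r` is not identically zero. -/
theorem exists_expSum_ne_zero (he : Function.Injective e) {c : ι → ℂ} {i : ι} (hi : c i ≠ 0) :
    ∃ m, expSum e c m ≠ 0 := by
  by_contra! h
  have hli := (linearIndependent_monoidHom (Laurent r) ℂ).comp
    (fun i => ((e i : Laurent r →+* ℂ) : Laurent r →* ℂ)) fun i j hij => he <| by
      exact AlgHom.ext fun x => DFunLike.congr_fun hij x
  refine hi (Fintype.linearIndependent_iff.mp hli c ?_ i)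
  have h2 : ∑ i, c i • (e i).toLinearMap = 0 := laurent_hom_ext fun m => by
    simpa [expSum] using h m
  funext x
  simpa using LinearMap.congr_fun h2 x

/-- The degrees at which one of the exponential sums attached to the family `C` is nonzero. -/
def expSupport (C : Set (ι → ℂ)) : Set (Fin r → ℤ) := {m | ∃ c ∈ C, expSum e c m ≠ 0}

theorem neg_mem_closure_expSupport (C : Set (ι → ℂ)) {m : Fin r → ℤ}
    (hm : m ∈ AddSubmonoid.closure (expSupport e C)) :
    -m ∈ AddSubmonoid.closure (expSupport e C) := by
  induction hm using AddSubmonoid.closure_induction with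
  | mem m hm =>
    obtain ⟨c, hc, hne⟩ := hm
    obtain ⟨q, hq, h⟩ := exists_pos_expSum_ne_zero e c (-(2 • m)) hne
    obtain ⟨p, rfl⟩ := Nat.exists_eq_succ_of_ne_zero hq.ne'
    have h1 : m + (p + 1) • -(2 • m) ∈ AddSubmonoid.closure (expSupport e C) :=
      AddSubmonoid.subset_closure (show _ ∈ expSupport e C from ⟨c, hc, h⟩)
    have h2 : (2 * p) • m ∈ AddSubmonoid.closure (expSupport e C) :=
      nsmul_mem (AddSubmonoid.subset_closure (show _ ∈ expSupport e C from ⟨c, hc, hne⟩)) _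
    convert add_mem h1 h2 using 1
    module
  | zero => simp
  | add x y _ _ hx hy => rw [neg_add]; exact add_mem hx hy

/-- The subgroup generated, even as a monoid, by the degrees in `expSupport e C`. -/
def expSubgroup (C : Set (ι → ℂ)) : AddSubgroup (Fin r → ℤ) where
  toAddSubmonoid := AddSubmonoid.closure (expSupport e C)
  neg_mem' hm := neg_mem_closure_expSupport e C hm

theorem finrank_finiteIndex_of_torsion {r : ℕ} (G : AddSubgroup (Fin r → ℤ))
    (h : ∀ m : Fin r → ℤ, ∃ q : ℕ, 0 < q ∧ q • m ∈ G) :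
    Module.finrank ℤ G = r ∧ G.FiniteIndex := by
  let N : Submodule ℤ (Fin r → ℤ) := AddSubgroup.toIntSubmodule G
  have htor : Module.IsTorsion ℤ ((Fin r → ℤ) ⧸ N) := by
    intro x
    obtain ⟨m, rfl⟩ := N.mkQ_surjective x
    obtain ⟨q, hq, hm⟩ := h m
    refine ⟨⟨(q : ℤ), mem_nonZeroDivisors_of_ne_zero (by omega)⟩, ?_⟩
    change (q : ℤ) • N.mkQ m = 0
    rw [← map_smul, natCast_zsmul]
    exact (Submodule.Quotient.mk_eq_zero N).mpr hm
  have hfin : Finite ((Fin r → ℤ) ⧸ N) := Module.finite_of_fg_torsion _ htor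
  have hrank : Module.finrank ℤ ((Fin r → ℤ) ⧸ N) = 0 :=
    Module.finrank_eq_zero_of_rank_eq_zero (Module.rank_eq_zero_iff_isTorsion.mpr htor)
  have hsum := N.finrank_quotient_add_finrank
  rw [hrank, zero_add, Module.finrank_fin_fun] at hsum
  refine ⟨hsum, ?_⟩
  have : Finite ((Fin r → ℤ) ⧸ G) := hfin
  exact AddSubgroup.finiteIndex_of_finite_quotient

theorem expSubgroup_finiteIndex (C : Set (ι → ℂ)) {m : Fin r → ℤ} (hm : m ∈ expSupport e C) :
    Module.finrank ℤ (expSubgroup e C) = r ∧ (expSubgroup e C).FiniteIndex := by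
  refine finrank_finiteIndex_of_torsion _ fun n => ?_
  obtain ⟨c, hc, hne⟩ := hm
  obtain ⟨q, hq, h⟩ := exists_pos_expSum_ne_zero e c n hne
  refine ⟨q, hq, ?_⟩
  have h1 : m ∈ expSubgroup e C := AddSubmonoid.subset_closure ⟨c, hc, hne⟩
  have h2 : m + q • n ∈ expSubgroup e C := AddSubmonoid.subset_closure ⟨c, hc, h⟩
  simpa using sub_mem h2 h1

end ExponentialSums

section ScalarOperators

variable {r : ℕ} {ι : Type*} {X : ι → Type*} [∀ i, AddCommGroup (X i)] [∀ i, Module ℂ (X i)]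

theorem exists_dual_pureTensor_eq_one [Fintype ι] {v : ∀ i, X i} (hv : ∀ i, v i ≠ 0) :
    ∃ lam : TensorModule X →ₗ[ℂ] ℂ, lam (pureTensor X v) = 1 := by
  choose f hf using fun i => Module.Projective.exists_dual_eq_one ℂ (hv i)
  refine ⟨PiTensorProduct.lift ((MultilinearMap.mkPiAlgebra ℂ ι ℂ).compLinearMap f), ?_⟩
  refine (PiTensorProduct.lift.tprod v).trans ?_
  simp [hf]

/-- The Laurent polynomials whose exponents lie in a given submonoid. -/
def supportedIn (P : AddSubmonoid (Fin r → ℤ)) : Subalgebra ℂ (Laurent r) where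
  carrier := {a | ∀ m, a.coeff m ≠ 0 → m ∈ P}
  mul_mem' {a b} ha hb m hm := by
    classical
    by_contra h
    refine hm ?_
    rw [AddMonoidAlgebra.coeff_mul]
    refine Finset.sum_eq_zero fun x hx => Finset.sum_eq_zero fun y hy => if_neg ?_
    rintro rfl
    exact h (add_mem (ha x (Finsupp.mem_support_iff.mp hx)) (hb y (Finsupp.mem_support_iff.mp hy)))
  add_mem' {a b} ha hb m hm := by
    by_contra h
    refine hm ?_
    have h1 := not_imp_comm.mp (ha m) h
    have h2 := not_imp_comm.mp (hb m) h
    rw [AddMonoidAlgebra.coeff_add, Finsupp.add_apply, h1, h2, add_zero]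
  algebraMap_mem' s m hm := by
    by_contra h
    refine hm ?_
    have : m ≠ 0 := fun h0 => h (h0 ▸ zero_mem P)
    simp [AddMonoidAlgebra.coeff_single, this.symm]

theorem smul_mono_mem_supportedIn {P : AddSubmonoid (Fin r → ℤ)} {m : Fin r → ℤ} {s : ℂ}
    (h : s ≠ 0 → m ∈ P) : s • mono m ∈ supportedIn P := by
  intro n hn
  by_cases hs : s = 0
  · simp [hs] at hn
  · by_cases hmn : m = n
    · exact hmn ▸ h hs
    · simp [AddMonoidAlgebra.coeff_single, hmn] at hn

/-- The operators on `X ⊗ ℂ[t₂^{±1},…,t_k^{±1}]` that act on `w ⊗ ℂ[t₂^{±1},…,t_k^{±1}]` as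
multiplication by an element of `𝓑`. -/
def scalarOps (w : TensorModule X) (𝓑 : Subalgebra ℂ (Laurent r)) :
    Subalgebra ℂ (Module.End ℂ (LoopModule r X)) where
  carrier := {T | ∃ a ∈ 𝓑, ∀ f, T (w ⊗ₜ f) = w ⊗ₜ (a * f)}
  mul_mem' := by
    rintro S T ⟨a, ha, hS⟩ ⟨b, hb, hT⟩
    exact ⟨a * b, mul_mem ha hb, fun f => by rw [Module.End.mul_apply, hT, hS, mul_assoc]⟩
  add_mem' := by
    rintro S T ⟨a, ha, hS⟩ ⟨b, hb, hT⟩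
    exact ⟨a + b, add_mem ha hb, fun f => by
      rw [LinearMap.add_apply, hT, hS, add_mul, TensorProduct.tmul_add]⟩
  algebraMap_mem' s := ⟨algebraMap ℂ _ s, 𝓑.algebraMap_mem s, fun f => by
    rw [Module.algebraMap_end_apply, ← Algebra.smul_def, TensorProduct.tmul_smul]⟩

variable (r) in
/-- `w ⊗ f ↦ λ(w) f`. -/
def loopContract (lam : TensorModule X →ₗ[ℂ] ℂ) : LoopModule r X →ₗ[ℂ] Laurent r :=
  (TensorProduct.lid ℂ (Laurent r)).toLinearMap ∘ₗ lam.rTensor (Laurent r)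

theorem loopContract_tmul (lam : TensorModule X →ₗ[ℂ] ℂ) (w : TensorModule X) (f : Laurent r) :
    loopContract r lam (w ⊗ₜ f) = lam w • f := rfl

variable {w : TensorModule X} {lam : TensorModule X →ₗ[ℂ] ℂ}

theorem apply_tmul_of_mem_scalarOps (hw : lam w = 1) {𝓑 : Subalgebra ℂ (Laurent r)}
    {T : Module.End ℂ (LoopModule r X)} (hT : T ∈ scalarOps w 𝓑) (f : Laurent r) :
    T (w ⊗ₜ f) = w ⊗ₜ (loopContract r lam (T (w ⊗ₜ 1)) * f) := by
  obtain ⟨a, -, ha⟩ := hT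
  rw [ha, ha, loopContract_tmul, hw, one_smul, mul_one]

/-- The Laurent polynomial by which an operator in `scalarOps w 𝓑` multiplies. -/
def symbol (hw : lam w = 1) (𝓑 : Subalgebra ℂ (Laurent r)) : scalarOps w 𝓑 →ₐ[ℂ] Laurent r :=
  AlgHom.ofLinearMap
    (loopContract r lam ∘ₗ LinearMap.applyₗ (w ⊗ₜ 1) ∘ₗ (scalarOps w 𝓑).val.toLinearMap)
    (by
      change loopContract r lam (w ⊗ₜ 1) = 1
      rw [loopContract_tmul, hw, one_smul])
    (fun S T => by
      change loopContract r lam (S.1 (T.1 (w ⊗ₜ 1))) =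
        loopContract r lam (S.1 (w ⊗ₜ 1)) * loopContract r lam (T.1 (w ⊗ₜ 1))
      rw [apply_tmul_of_mem_scalarOps hw T.2, mul_one, apply_tmul_of_mem_scalarOps hw S.2,
        loopContract_tmul, loopContract_tmul, hw, one_smul, one_smul])

theorem apply_tmul_eq_symbol (hw : lam w = 1) (𝓑 : Subalgebra ℂ (Laurent r))
    (T : scalarOps w 𝓑) (f : Laurent r) : T.1 (w ⊗ₜ f) = w ⊗ₜ (symbol hw 𝓑 T * f) :=
  apply_tmul_of_mem_scalarOps hw T.2 f

theorem symbol_eq (hw : lam w = 1) (𝓑 : Subalgebra ℂ (Laurent r)) (T : scalarOps w 𝓑)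
    {a : Laurent r} (ha : T.1 (w ⊗ₜ 1) = w ⊗ₜ a) : symbol hw 𝓑 T = a := by
  change loopContract r lam (T.1 (w ⊗ₜ 1)) = a
  rw [ha, loopContract_tmul, hw, one_smul]

variable (r X) in
/-- `w ⊗ f ↦ f_m w`, where `f_m` is the coefficient of `t^m` in `f`. -/
def loopComponent (m : Fin r → ℤ) : LoopModule r X →ₗ[ℂ] TensorModule X :=
  (TensorProduct.rid ℂ (TensorModule X)).toLinearMap ∘ₗ
    LinearMap.lTensor _ (Finsupp.lapply m ∘ₗ (AddMonoidAlgebra.coeffLinearEquiv ℂ).toLinearMap)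

theorem loopComponent_tmul (m : Fin r → ℤ) (w : TensorModule X) (f : Laurent r) :
    loopComponent r X m (w ⊗ₜ f) = f.coeff m • w := rfl

theorem degreeSet_orbit (hw : lam w = 1) {S : Set (Fin r → ℤ)}
    {𝒜 : Subalgebra ℂ (Module.End ℂ (LoopModule r X))}
    (h𝒜 : 𝒜 ≤ scalarOps w (supportedIn (AddSubmonoid.closure S)))
    (hS : ∀ m ∈ S, ∃ T ∈ 𝒜, ∃ s : ℂ, s ≠ 0 ∧ ∀ f, T (w ⊗ₜ f) = s • (w ⊗ₜ (mono m * f))) :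
    degreeSet (orbit 𝒜 (w ⊗ₜ 1)) = AddSubmonoid.closure S := by
  have hne : w ≠ 0 := fun h => by simp [h] at hw
  ext m
  constructor
  · rintro ⟨x, ⟨T, hT, hx⟩, hx0⟩
    obtain ⟨a, ha, hTa⟩ := h𝒜 hT
    refine ha m fun h0 => hx0 ?_
    have h1 : (w ⊗ₜ a : LoopModule r X) = x ⊗ₜ mono m := by
      rw [← hx, ← mul_one a, ← hTa]; rfl
    have h2 := congrArg (loopComponent r X m) h1
    rw [loopComponent_tmul, loopComponent_tmul, h0, zero_smul, AddMonoidAlgebra.coeff_single,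
      Finsupp.single_eq_same, one_smul] at h2
    rw [← h2, TensorProduct.zero_tmul]
  · intro hm
    have key : ∃ T ∈ 𝒜, ∃ s : ℂ, s ≠ 0 ∧ ∀ f, T (w ⊗ₜ f) = s • (w ⊗ₜ (mono m * f)) := by
      induction hm using AddSubmonoid.closure_induction with
      | mem m hm => exact hS m hm
      | zero => exact ⟨1, one_mem _, 1, one_ne_zero, fun f => by
          rw [Module.End.one_apply, one_smul, show (mono 0 : Laurent r) = 1 from rfl, one_mul]⟩
      | add x y _ _ hx hy =>
        obtain ⟨T, hT, s, hs, h⟩ := hx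
        obtain ⟨T', hT', s', hs', h'⟩ := hy
        refine ⟨T * T', mul_mem hT hT', s' * s, mul_ne_zero hs' hs, fun f => ?_⟩
        rw [Module.End.mul_apply, h', map_smul, h, mono_add, mul_assoc, smul_smul]
    obtain ⟨T, hT, s, hs, h⟩ := key
    have h1 : T (w ⊗ₜ 1) = (s • w) ⊗ₜ mono m := by rw [h, mul_one, TensorProduct.smul_tmul']
    refine ⟨s • w, ⟨T, hT, h1⟩, fun h0 => ?_⟩
    have h2 := congrArg (loopComponent r X m) h0
    rw [loopComponent_tmul, map_zero, AddMonoidAlgebra.coeff_single, Finsupp.single_eq_same,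
      one_smul] at h2
    exact smul_ne_zero hs hne h2

end ScalarOperators

section WeightVectors

open LieAlgebra.IsKilling

variable {g : Type*} [LieRing g] [LieAlgebra ℂ g] {c : ℂ}
variable {r : ℕ} {ι : Type*} {X : ι → Type*} [∀ i, AddCommGroup (X i)] [∀ i, Module ℂ (X i)]
variable [∀ i, LieRingModule (AffineAlgebra g c) (X i)] [∀ i, LieModule ℂ (AffineAlgebra g c) (X i)]
variable {v : ∀ i, X i}

theorem legOp_pureTensor {i : ι} {Y : AffineAlgebra g c} {s : ℂ} (h : ⁅Y, v i⁆ = s • v i) :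
    legOp X i Y (pureTensor X v) = s • pureTensor X v := by
  classical
  change PiTensorProduct.map _ (PiTensorProduct.tprod ℂ v) = s • PiTensorProduct.tprod ℂ v
  rw [PiTensorProduct.map_tprod]
  have : (fun j => (Function.update (fun j => (1 : Module.End ℂ (X j))) i
      (LieModule.toEnd ℂ (AffineAlgebra g c) (X i) Y) j) (v j)) =
      Function.update v i (s • v i) := by
    funext j
    by_cases hj : j = i
    · subst hj; simpa using h
    · simp [hj]
  have h2 := (PiTensorProduct.tprod ℂ).map_update_smul v i s (v i)
  rw [Function.update_eq_self] at h2
  rw [← h2, ← this]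
  congr!

variable [Fintype ι] (e : ι → (Laurent r →ₐ[ℂ] ℂ))

theorem currentOp_pureTensor {m : Fin r → ℤ} {Y : AffineAlgebra g c} {s : ι → ℂ}
    (h : ∀ i, ⁅Y, v i⁆ = s i • v i) (f : Laurent r) :
    currentOp X e m Y (pureTensor X v ⊗ₜ f) =
      expSum e s m • (pureTensor X v ⊗ₜ (mono m * f)) := by
  rw [currentOp_tmul, TensorProduct.smul_tmul', evalOp, expSum, LinearMap.sum_apply,
    LinearMap.sum_apply, Finset.sum_smul]
  congr 1
  refine Finset.sum_congr rfl fun i _ => ?_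
  rw [LinearMap.smul_apply, LinearMap.smul_apply, legOp_pureTensor (h i), smul_smul, mul_comm]

theorem currentOp_mem_scalarOps {P : AddSubmonoid (Fin r → ℤ)} {m : Fin r → ℤ}
    {Y : AffineAlgebra g c} {s : ι → ℂ} (h : ∀ i, ⁅Y, v i⁆ = s i • v i)
    (hm : expSum e s m ≠ 0 → m ∈ P) :
    currentOp X e m Y ∈ scalarOps (pureTensor X v) (supportedIn P) :=
  ⟨expSum e s m • mono m, smul_mono_mem_supportedIn hm, fun f => by
    rw [currentOp_pureTensor e h, smul_mul_assoc, TensorProduct.tmul_smul]⟩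

theorem loopModuleRep_loopEl (m : Fin r → ℤ) (x : g) :
    loopModuleRep X g c e (loopEl (tailExp m) x) = currentOp (c := c) X e m (loopEl 0 x) := by
  change repLoop X g c e _ + repCen X g c e 0 + repDer X g c e 0 = _
  rw [map_zero, map_zero, add_zero, add_zero]
  exact repLoop_single X e (tailExp m) x

theorem loopModuleRep_cenEl (m : Fin r → ℤ) (u : Fin (r + 1) → ℂ) :
    loopModuleRep X g c e (cenEl (tailExp m) u) = currentOp (g := g) (c := c) X e m (cenEl 0 fun _ => u 0) := by
  change repLoop X g c e 0 + repCen X g c e _ + repDer X g c e 0 = _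
  rw [map_zero, map_zero, zero_add, add_zero]
  exact repCen_mk X e (tailExp m) u

theorem loopModuleRep_derEl :
    loopModuleRep X g c e (derEl (Pi.single 0 1)) = currentOp (g := g) (c := c) X e 0 (derEl fun _ => 1) := by
  change repLoop X g c e 0 + repCen X g c e 0 + repDer X g c e (Pi.single 0 1) = _
  rw [map_zero, map_zero, zero_add, zero_add, repDer_apply]
  have : Fin.tail (Pi.single 0 1 : Fin (r + 1) → ℂ) = 0 := by
    funext i; simp [Fin.tail]
  rw [this, map_zero, add_zero]
  simp

end WeightVectors

theorem range_lift_le {L A : Type*} [LieRing L] [LieAlgebra ℂ L] [Ring A] [Algebra ℂ A]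
    {B : Subalgebra ℂ A} (f : L →ₗ⁅ℂ⁆ A) (hf : ∀ x, f x ∈ B) :
    (UniversalEnvelopingAlgebra.lift ℂ f).range ≤ B := by
  let f' : L →ₗ⁅ℂ⁆ B :=
    { toFun := fun x => ⟨f x, hf x⟩
      map_add' := fun x y => Subtype.ext (map_add f x y)
      map_smul' := fun s x => Subtype.ext (map_smul f s x)
      map_lie' := fun {x y} => Subtype.ext (LieHom.map_lie f x y) }
  have hF : B.val.comp (UniversalEnvelopingAlgebra.lift ℂ f') =
      UniversalEnvelopingAlgebra.lift ℂ f := by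
    apply UniversalEnvelopingAlgebra.hom_ext
    ext x
    change (UniversalEnvelopingAlgebra.lift ℂ f' (UniversalEnvelopingAlgebra.ι ℂ x)).1 =
      UniversalEnvelopingAlgebra.lift ℂ f (UniversalEnvelopingAlgebra.ι ℂ x)
    rw [UniversalEnvelopingAlgebra.lift_ι_apply, UniversalEnvelopingAlgebra.lift_ι_apply]
    rfl
  rw [← hF]
  rintro _ ⟨u, rfl⟩
  exact (UniversalEnvelopingAlgebra.lift ℂ f' u).2

section HighestWeight

open LieAlgebra.IsKilling

variable {g : Type*} [LieRing g] [LieAlgebra ℂ g] {H : LieSubalgebra ℂ g} {c : ℂ}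
variable {r : ℕ} {ι : Type*} {X : ι → Type*} [∀ i, AddCommGroup (X i)] [∀ i, Module ℂ (X i)]
variable [∀ i, LieRingModule (AffineAlgebra g c) (X i)] [∀ i, LieModule ℂ (AffineAlgebra g c) (X i)]
variable [Fintype ι] {e : ι → (Laurent r →ₐ[ℂ] ℂ)} {v : ∀ i, X i}
variable {mu : ι → Module.Dual ℂ (CartanAff H)}

variable (mu) in
/-- The coefficient families `i ↦ μ_i(h)` for `h ∈ h ⊕ ℂK₁`. -/
def levelCoeffs : Set (ι → ℂ) := Set.range fun h : H × ℂ => fun i => mu i (h.1, h.2, 0)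

variable (mu) in
/-- The coefficient families `i ↦ μ_i(h)` for `h ∈ h_aff`. -/
def weightCoeffs : Set (ι → ℂ) := Set.range fun h : CartanAff H => fun i => mu i h

theorem expSubgroup_levelCoeffs_finiteIndex (h : (∑ i, mu i) (0, 1, 0) ≠ 0) :
    Module.finrank ℤ (expSubgroup e (levelCoeffs mu)) = r ∧
      (expSubgroup e (levelCoeffs mu)).FiniteIndex := by
  refine expSubgroup_finiteIndex _ _ (m := 0) ⟨_, ⟨(0, 1), rfl⟩, ?_⟩
  rw [LinearMap.sum_apply] at h
  simpa only [expSum, show (mono 0 : Laurent r) = 1 from rfl, map_one, mul_one] using h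

theorem expSubgroup_weightCoeffs_finiteIndex (he : Function.Injective e) {i : ι}
    (hi : mu i ≠ 0) :
    Module.finrank ℤ (expSubgroup e (weightCoeffs mu)) = r ∧
      (expSubgroup e (weightCoeffs mu)).FiniteIndex := by
  obtain ⟨x, hx⟩ : ∃ x, mu i x ≠ 0 := by
    by_contra! h0
    exact hi (LinearMap.ext h0)
  obtain ⟨m, hm⟩ := exists_expSum_ne_zero e he (c := fun i => mu i x) hx
  exact expSubgroup_finiteIndex _ _ ⟨_, ⟨x, rfl⟩, hm⟩

theorem cartanAff_current (h : H) (a : ℂ) :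
    (cartanAff (h, a, 0) : AffineAlgebra g c) = loopEl 0 (h : g) + cenEl 0 fun _ => a := by
  simp only [cartanAff, LinearMap.coprod_apply, LinearMap.comp_apply, map_zero, add_zero,
    LinearMap.toSpanSingleton_apply]
  congr 2
  funext i
  simp

theorem cartanAff_der :
    (cartanAff ((0, 0, 1) : CartanAff H) : AffineAlgebra g c) = derEl fun _ => 1 := by
  simp only [cartanAff, LinearMap.coprod_apply, LinearMap.comp_apply, map_zero, zero_add,
    LinearMap.toSpanSingleton_apply, one_smul]

variable (hv : ∀ i (h : CartanAff H), ⁅(cartanAff h : AffineAlgebra g c), v i⁆ = mu i h • v i)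

include hv in
theorem uAct_range_le :
    (uAct X H c e).range ≤ scalarOps (pureTensor X v)
      (supportedIn (AddSubmonoid.closure (expSupport e (levelCoeffs mu)))) := by
  set 𝓒 := scalarOps (pureTensor X v)
      (supportedIn (AddSubmonoid.closure (expSupport e (levelCoeffs mu)))) with h𝓒
  have hcur : ∀ (m : Fin r → ℤ) (h : H) (a : ℂ),
      currentOp X e m (cartanAff (h, a, 0) : AffineAlgebra g c) ∈ 𝓒 := fun m h a =>
    currentOp_mem_scalarOps e (fun i => hv i (h, a, 0)) fun hne =>
      AddSubmonoid.subset_closure ⟨_, ⟨(h, a), rfl⟩, hne⟩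
  have hrep : cartanLoop H c r ≤
      (lieSubalgebraOfSubalgebra ℂ _ 𝓒).comap (loopModuleRep X g c e) := by
    refine LieSubalgebra.lieSpan_le.mpr ?_
    rintro Y ((⟨m, h, rfl⟩ | ⟨m, u, rfl⟩) | rfl)
    · change loopModuleRep X g c e _ ∈ 𝓒
      rw [loopModuleRep_loopEl]
      have := hcur m h 0
      rw [cartanAff_current] at this
      convert this using 2
      exact (add_eq_left.mpr (map_zero _)).symm
    · change loopModuleRep X g c e _ ∈ 𝓒
      rw [loopModuleRep_cenEl]
      have := hcur m 0 (u 0)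
      rw [cartanAff_current] at this
      convert this using 2
      exact (add_eq_right.mpr (map_zero _)).symm
    · change loopModuleRep X g c e _ ∈ 𝓒
      rw [loopModuleRep_derEl, ← cartanAff_der (H := H)]
      exact currentOp_mem_scalarOps e (fun i => hv i _) fun _ => zero_mem _
  exact range_lift_le _ fun Y => hrep Y.2

include hv in
theorem fullCartanOps_le :
    fullCartanOps X H c e ≤ scalarOps (pureTensor X v)
      (supportedIn (AddSubmonoid.closure (expSupport e (weightCoeffs mu)))) := by
  refine Algebra.adjoin_le ?_
  rintro _ ⟨m, h, rfl⟩
  exact currentOp_mem_scalarOps e (fun i => hv i h) fun hne =>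
    AddSubmonoid.subset_closure ⟨_, ⟨h, rfl⟩, hne⟩

include hv in
theorem degreeSet_orbit_fullCartanOps (hv0 : ∀ i, v i ≠ 0) :
    degreeSet (orbit (fullCartanOps X H c e) (cyclicVec X r v)) =
      expSubgroup e (weightCoeffs mu) := by
  obtain ⟨lam, hlam⟩ := exists_dual_pureTensor_eq_one hv0
  refine degreeSet_orbit hlam (fullCartanOps_le hv) ?_
  rintro m ⟨_, ⟨h, rfl⟩, hne⟩
  exact ⟨_, Algebra.subset_adjoin ⟨m, h, rfl⟩, _, hne,
    fun f => currentOp_pureTensor e (fun i => hv i h) f⟩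

variable [FiniteDimensional ℂ g] [LieAlgebra.IsSimple ℂ g] [H.IsCartanSubalgebra]

theorem uAct_uCurrent (m : Fin r → ℤ) (h : H) (a : ℂ) :
    uAct X H c e (uCurrent m h a) = currentOp X e m (cartanAff (h, a, 0) : AffineAlgebra g c) := by
  rw [uAct, uCurrent, UniversalEnvelopingAlgebra.lift_ι_apply]
  change loopModuleRep X g c e (cartanCurrent m h a) = _
  rw [cartanCurrent, map_add, loopModuleRep_loopEl, loopModuleRep_cenEl, cartanAff_current,
    map_add, Pi.single_eq_same]

theorem uAct_uCentral (m : Fin r → ℤ) (j : Fin r) : uAct X H c e (uCentral m j.succ) = 0 := by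
  rw [uAct, uCentral, UniversalEnvelopingAlgebra.lift_ι_apply]
  change loopModuleRep X g c e (cenEl (tailExp m) (Pi.single j.succ 1)) = _
  rw [loopModuleRep_cenEl, Pi.single_eq_of_ne (Fin.succ_ne_zero j).symm]
  exact (congrArg _ (map_zero _)).trans (map_zero _)

theorem uAct_uCartan (h : CartanAff H) :
    uAct X H c e (uCartan h) = currentOp X e 0 (cartanAff h : AffineAlgebra g c) := by
  have h1 : uAct X H c e (UniversalEnvelopingAlgebra.ι ℂ
      ⟨derEl (Pi.single 0 1), derEl_mem_cartanLoop⟩) =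
      currentOp X e 0 (cartanAff ((0, 0, 1) : CartanAff H) : AffineAlgebra g c) := by
    rw [uAct, UniversalEnvelopingAlgebra.lift_ι_apply, cartanAff_der]
    exact loopModuleRep_derEl e
  rw [uCartan, map_add, map_smul, uAct_uCurrent, h1, ← map_smul, ← map_smul, ← map_add, ← map_add]
  congr 2
  simp

include hv in
theorem degreeSet_orbit_uAct (hv0 : ∀ i, v i ≠ 0) :
    degreeSet (orbit (uAct X H c e).range (cyclicVec X r v)) =
      expSubgroup e (levelCoeffs mu) := by
  obtain ⟨lam, hlam⟩ := exists_dual_pureTensor_eq_one hv0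
  refine degreeSet_orbit hlam (uAct_range_le hv) ?_
  rintro m ⟨_, ⟨⟨h, a⟩, rfl⟩, hne⟩
  exact ⟨_, ⟨uCurrent m h a, uAct_uCurrent m h a⟩, _, hne,
    fun f => currentOp_pureTensor e (fun i => hv i (h, a, 0)) f⟩

include hv in
/-- The enveloping algebra acts on the line spanned by a pure tensor of weight vectors, tensored
with the Laurent polynomials, through a character with values in the Laurent polynomials. -/
theorem exists_symbol (hv0 : ∀ i, v i ≠ 0) :
    ∃ φ : UCartan H c r →ₐ[ℂ] Laurent r,
      (∀ u f, uAct X H c e u (pureTensor X v ⊗ₜ f) = pureTensor X v ⊗ₜ (φ u * f)) ∧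
      (∀ m h a, φ (uCurrent m h a) = expSum e (fun i => mu i (h, a, 0)) m • mono m) ∧
      (∀ h, φ (uCartan h) = algebraMap ℂ _ (∑ i, mu i h)) ∧
      ∀ m (j : Fin r), φ (uCentral m j.succ) = 0 := by
  obtain ⟨lam, hlam⟩ := exists_dual_pureTensor_eq_one hv0
  let 𝓑 := supportedIn (AddSubmonoid.closure (expSupport e (levelCoeffs mu)))
  let F : UCartan H c r →ₐ[ℂ] scalarOps (pureTensor X v) 𝓑 :=
    (uAct X H c e).codRestrict _ fun u => uAct_range_le hv ⟨u, rfl⟩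
  refine ⟨(symbol hlam 𝓑).comp F, fun u f => apply_tmul_eq_symbol hlam 𝓑 (F u) f,
    fun m h a => symbol_eq hlam 𝓑 (F _) ?_, fun h => symbol_eq hlam 𝓑 (F _) ?_,
    fun m j => symbol_eq hlam 𝓑 (F _) ?_⟩
  · change uAct X H c e _ _ = _
    rw [uAct_uCurrent, currentOp_pureTensor e (fun i => hv i (h, a, 0)), mul_one,
      TensorProduct.tmul_smul]
  · change uAct X H c e _ _ = _
    rw [uAct_uCartan, currentOp_pureTensor e (fun i => hv i h), mul_one,
      Algebra.algebraMap_eq_smul_one, TensorProduct.tmul_smul, expSum]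
    simp only [show (mono 0 : Laurent r) = 1 from rfl, map_one, mul_one]
  · change uAct X H c e _ _ = _
    rw [uAct_uCentral, TensorProduct.tmul_zero, LinearMap.zero_apply]

variable {b : (rootSystem H).Base} {θ : H.root}

theorem map_pCoeff (φ : UCartan H c r →ₐ[ℂ] Laurent r) (i : Option b.support) (m : Fin r → ℤ)
    (s : ℕ) : φ (pCoeff b θ i m s) =
      expCoeff (PowerSeries.map (φ : UCartan H c r →+* Laurent r) (logSeries b θ i m)) s := by
  rw [pCoeff, expCoeff, map_sum]
  refine Finset.sum_congr rfl fun n _ => ?_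
  rw [map_smul, ← map_pow, PowerSeries.coeff_map]
  rfl

theorem map_relGen_eq_zero {Lam : Module.Dual ℂ (CartanAff H)} (hLam : ∑ i, mu i = Lam)
    (hmu : ∀ i, mu i ∈ PaffPlus b θ) (φ : UCartan H c r →ₐ[ℂ] Laurent r)
    (hcur : ∀ m h a, φ (uCurrent m h a) = expSum e (fun i => mu i (h, a, 0)) m • mono m)
    (hcar : ∀ h, φ (uCartan h) = algebraMap ℂ _ (∑ i, mu i h))
    (hcen : ∀ m (j : Fin r), φ (uCentral m j.succ) = 0)
    {u : UCartan H c r} (hu : RelGen c r b θ Lam u) : φ u = 0 := by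
  choose n hn using hmu
  have hcor : ∀ i, ((affCoroot b θ i).1, (affCoroot b θ i).2.1, (0 : ℂ)) = affCoroot b θ i := by
    rintro (_ | i) <;> rfl
  have hq : ∀ j m (q : ℕ), φ (uCurrent (q • m) (affCoroot b θ j).1 (affCoroot b θ j).2.1) =
      ∑ i, n i j • (e i (mono m) • mono m) ^ q := by
    intro j m q
    rw [hcur, hcor, expSum, Finset.sum_smul]
    refine Finset.sum_congr rfl fun i _ => ?_
    rw [hn, mono_nsmul, map_pow, mul_smul, smul_pow, Nat.cast_smul_eq_nsmul]
  have hlog : ∀ j m q, PowerSeries.coeff q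
      (PowerSeries.map (φ : UCartan H c r →+* Laurent r) (logSeries b θ j m)) =
      if q = 0 then 0 else (-(q : ℂ)⁻¹) • ∑ i, n i j • (e i (mono m) • mono m) ^ q := by
    intro j m q
    rw [PowerSeries.coeff_map, logSeries, PowerSeries.coeff_mk]
    split_ifs with h0
    · exact map_zero _
    · rw [← hq]; exact map_smul φ _ _
  have hsum : ∀ j (N : ℕ), Lam (affCoroot b θ j) = N → ∑ i, n i j = N := by
    intro j N hN
    rw [← hLam, LinearMap.sum_apply] at hN
    simp only [hn] at hN
    exact_mod_cast hN
  induction hu with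
  | cartan h =>
    rw [map_sub, hcar, AlgHom.commutes, ← hLam, LinearMap.sum_apply, sub_self]
  | central m j => exact hcen m j
  | coeff j m N s hN hs =>
    rw [map_pCoeff]
    exact expCoeff_eq_zero (hlog j m) (by rwa [hsum j N hN])
  | sum j m N s hN hs =>
    rw [map_sum]
    simp only [map_mul, map_pCoeff, hq]
    exact sum_mul_expCoeff_eq_zero (hlog j m) (by rwa [hsum j N hN])

include hv in
theorem exists_ALam_action {Lam : Module.Dual ℂ (CartanAff H)} (hLam : ∑ i, mu i = Lam)
    (hmu : ∀ i, mu i ∈ PaffPlus b θ) (hv0 : ∀ i, v i ≠ 0)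
    (N : Submodule ℂ (LoopModule r X))
    (hN : N = orbit (uAct X H c e).range (cyclicVec X r v)) :
    ∃ ψ : ALam c r b θ Lam →+* Module.End ℂ N, ∀ u (w : N),
      (ψ ((relIdeal c r b θ Lam).ringCon.mk' u) w : LoopModule r X) = uAct X H c e u w := by
  obtain ⟨φ, hφ, hcur, hcar, hcen⟩ := exists_symbol (e := e) hv hv0
  have hmem : ∀ x ∈ N, ∃ f, x = pureTensor X v ⊗ₜ f := by
    intro x hx
    rw [hN] at hx
    obtain ⟨_, ⟨u, rfl⟩, rfl⟩ := hx
    exact ⟨_, hφ u 1⟩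
  have hstab : ∀ u, ∀ x ∈ N, uAct X H c e u x ∈ N := by
    intro u x hx
    rw [hN] at hx ⊢
    obtain ⟨_, ⟨u', rfl⟩, rfl⟩ := hx
    exact ⟨_, ⟨u * u', rfl⟩, by simp [map_mul]⟩
  let ρ : UCartan H c r →+* Module.End ℂ N :=
    { toFun := fun u => (uAct X H c e u).restrict (hstab u)
      map_one' := by ext x; simp
      map_mul' := fun u u' => by ext x; simp
      map_zero' := by ext x; simp
      map_add' := fun u u' => by ext x; simp }
  have hle : relIdeal c r b θ Lam ≤ TwoSidedIdeal.ker ρ := by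
    refine TwoSidedIdeal.span_le.mpr fun u hu => ?_
    refine TwoSidedIdeal.mem_ker ρ |>.mpr ?_
    ext ⟨x, hx⟩
    obtain ⟨f, rfl⟩ := hmem x hx
    change uAct X H c e u (pureTensor X v ⊗ₜ f) = 0
    rw [hφ, map_relGen_eq_zero hLam hmu φ hcur hcar hcen hu, zero_mul, TensorProduct.tmul_zero]
  have hker : (relIdeal c r b θ Lam).ringCon ≤ RingCon.ker ρ :=
    fun _ _ h => TwoSidedIdeal.ringCon_le_iff.mp hle h
  exact ⟨RingCon.lift _ ρ hker, fun u w => rfl⟩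

end HighestWeight

theorem evAt_injective {r : ℕ} : Function.Injective (evAt (r := r)) := by
  have hker : ∀ (M : MaximalSpectrum (Laurent r)) x, evAt M x = 0 ↔ x ∈ M.asIdeal := by
    intro M x
    simp [evAt, Ideal.Quotient.eq_zero_iff_mem]
  intro M M' h
  ext x
  rw [← hker, ← hker, h]

end Toroidal

end

theorem mainTheorem6 {g : Type*} [LieRing g] [LieAlgebra ℂ g] [FiniteDimensional ℂ g]
    [LieAlgebra.IsSimple ℂ g] (H : LieSubalgebra ℂ g) [H.IsCartanSubalgebra]
    (b : (LieAlgebra.IsKilling.rootSystem H).Base) (θ : H.root)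
    (hθ : Toroidal.IsHighestRoot H b θ) (r : ℕ)
    (π : MaximalSpectrum (Toroidal.Laurent r) →₀ Toroidal.PaffPlus b θ)
    (Lam : Module.Dual ℂ (Toroidal.CartanAff H)) (hLam : Toroidal.wt π = Lam)
    (X : π.support → Type*) [∀ M, AddCommGroup (X M)] [∀ M, Module ℂ (X M)]
    [∀ M, LieRingModule (AffineAlgebra g (Toroidal.normScale H θ)) (X M)]
    [∀ M, LieModule ℂ (AffineAlgebra g (Toroidal.normScale H θ)) (X M)]
    (v : ∀ M, X M)
    (hX : ∀ M : π.support, Toroidal.IsHighestWeightModule b (c := Toroidal.normScale H θ)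
      (π M.1 : Module.Dual ℂ (Toroidal.CartanAff H)) (X M) (v M))
    (U : UniversalEnvelopingAlgebra ℂ (Toroidal.cartanLoop H (Toroidal.normScale H θ) r) →ₐ[ℂ]
      Module.End ℂ (Toroidal.LoopModule r X))
    (hU : U = Toroidal.uAct X H (Toroidal.normScale H θ) fun M => Toroidal.evAt M.1)
    (N : Submodule ℂ (Toroidal.LoopModule r X))
    (hN : N = Toroidal.orbit U.range (Toroidal.cyclicVec X r v))
    (N' : Submodule ℂ (Toroidal.LoopModule r X))
    (hN' : N' = Toroidal.orbit
      (Toroidal.fullCartanOps X H (Toroidal.normScale H θ) fun M => Toroidal.evAt M.1)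
      (Toroidal.cyclicVec X r v)) :
    (∃ ψ : Toroidal.ALam (Toroidal.normScale H θ) r b θ Lam →+* Module.End ℂ N,
      ∀ u (w : N), (ψ ((Toroidal.relIdeal (Toroidal.normScale H θ) r b θ Lam).ringCon.mk' u) w :
        Toroidal.LoopModule r X) = U u w) ∧
    (∃ G : AddSubgroup (Fin r → ℤ), (G : Set (Fin r → ℤ)) = Toroidal.degreeSet N ∧
      (Lam (0, 1, 0) ≠ 0 → Module.finrank ℤ G = r ∧ G.FiniteIndex)) ∧
    (∃ G : AddSubgroup (Fin r → ℤ), (G : Set (Fin r → ℤ)) = Toroidal.degreeSet N' ∧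
      (π ≠ 0 → Module.finrank ℤ G = r ∧ G.FiniteIndex)) := by
  have hv : ∀ (M : π.support) (h : Toroidal.CartanAff H),
      ⁅(Toroidal.cartanAff h : AffineAlgebra g (Toroidal.normScale H θ)), v M⁆ =
        (π M.1 : Module.Dual ℂ (Toroidal.CartanAff H)) h • v M := fun M => (hX M).weight
  have hv0 : ∀ M, v M ≠ 0 := fun M => (hX M).ne_zero
  have hsum : ∑ M : π.support, (π M.1 : Module.Dual ℂ (Toroidal.CartanAff H)) = Lam :=
    (Finset.sum_coe_sort π.support
      fun M => (π M : Module.Dual ℂ (Toroidal.CartanAff H))).trans hLam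
  refine ⟨?_, ?_, ?_⟩
  · subst hU
    exact Toroidal.exists_ALam_action hv hsum (fun M => (π M.1).2) hv0 N hN
  · refine ⟨Toroidal.expSubgroup (fun M : π.support => Toroidal.evAt M.1)
      (Toroidal.levelCoeffs fun M : π.support => (π M.1 : Module.Dual ℂ (Toroidal.CartanAff H))), ?_, fun h => ?_⟩
    · rw [hN, hU]
      exact (Toroidal.degreeSet_orbit_uAct hv hv0).symm
    · rw [← hsum] at h
      exact Toroidal.expSubgroup_levelCoeffs_finiteIndex h
  · refine ⟨Toroidal.expSubgroup (fun M : π.support => Toroidal.evAt M.1)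
      (Toroidal.weightCoeffs fun M : π.support => (π M.1 : Module.Dual ℂ (Toroidal.CartanAff H))), ?_, fun h => ?_⟩
    · rw [hN']
      exact (Toroidal.degreeSet_orbit_fullCartanOps hv hv0).symm
    · obtain ⟨M, hM⟩ := Finsupp.support_nonempty_iff.mpr h
      exact Toroidal.expSubgroup_weightCoeffs_finiteIndex
        (Toroidal.evAt_injective.comp Subtype.val_injective) (i := ⟨M, hM⟩)
        fun h0 => Finsupp.mem_support_iff.mp hM (Subtype.ext h0)
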